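/- Let $d\in\mathbb N$ and let $\mathbb T^d=\mathbb R^d/\mathbb Z^d$, with the metric induced by the maximum norm and with Haar probability measure $m$. Let $S$ and $T$ be quasihyperbolic endomorphisms of $\mathbb T^d$, that is, endomorphisms given by $d\times d$ integer matrices that are nonsingular and have no eigenvalue which is a root of unity. Let $\mathfrak s_-\subset\mathbb R^d$ be the subspace contracted by $S$, i.e. the real subspace corresponding to the eigenvalues of $S$ of modulus less than $1$ (the real points of the sum of the complex generalized eigenspaces of these eigenvalues), and let $\mathfrak s_0'\subset\mathbb R^d$ be the sum of the eigenspaces of $S$ for the eigenvalues of modulus $1$ (the real points of the sum of the complex eigenspaces of these eigenvalues, not of the generalized ones). Define $\mathfrak t_-$ and $\mathfrak t_0'$ in the same way for $T$. Assume that $\mathfrak s_-\oplus\mathfrak s_0'$ and $\mathfrak t_-\oplus\mathfrak t_0'$ are both nontrivial (different from $\{0\}$) and that together they span $\mathbb R^d$. Put $$Eq(S)=\Big\{x\in\mathbb T^d:\ \frac1N\sum_{n=0}^{N-1}f(S^nx)\xrightarrow[N\to\infty]{}\int_{\mathbb T^d} f\,dm\ \text{ for all } f\in C(\mathbb T^d)\Big\}$$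 and $NEq(T)=\mathbb T^d\setminus Eq(T)$, where $Eq(T)$ is defined in the same way for $T$. Then $$\dim\big(Eq(S)\cap NEq(T)\big)=d,$$ where $\dim$ denotes Hausdorff dimension. -/

import Mathlib

open Filter Topology MeasureTheory

noncomputable section

/-- The endomorphism of the torus `ℝ^d / ℤ^d` given by an integer matrix `A`,
i.e. the map induced by `v ↦ A v` on `ℝ^d` (see `toralMap_coe`). -/
def toralMap {d : ℕ} (A : Matrix (Fin d) (Fin d) ℤ) (x : UnitAddTorus (Fin d)) :
    UnitAddTorus (Fin d) :=
  fun i => ∑ j, A i j • x j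

theorem toralMap_coe {d : ℕ} (A : Matrix (Fin d) (Fin d) ℤ) (v : Fin d → ℝ) :
    toralMap A (fun i => ((v i : ℝ) : UnitAddCircle)) =
      fun i => (((A.map (Int.cast : ℤ → ℝ)).mulVec v i : ℝ) : UnitAddCircle) := by
  funext i
  simp only [toralMap, Matrix.mulVec, dotProduct, Matrix.map_apply]
  rw [← QuotientAddGroup.mk'_apply, map_sum]
  refine Finset.sum_congr rfl fun j _ => ?_
  rw [← zsmul_eq_mul, map_zsmul]
  rfl

/-- The `ℂ`-linear extension to `ℂ^d` of the linear map `v ↦ A v`. -/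
def complexEnd {d : ℕ} (A : Matrix (Fin d) (Fin d) ℤ) : Module.End ℂ (Fin d → ℂ) :=
  Matrix.toLin' (A.map (Int.cast : ℤ → ℂ))

/-- `A` is nonsingular and no eigenvalue of `A` is a root of unity. -/
def IsQuasihyperbolic {d : ℕ} (A : Matrix (Fin d) (Fin d) ℤ) : Prop :=
  A.det ≠ 0 ∧
    ∀ μ : ℂ, (complexEnd A).HasEigenvalue μ → ∀ n : ℕ, 0 < n → μ ^ n ≠ 1

/-- The real points `{v ∈ ℝ^d : v ∈ W}` of a complex subspace `W` of `ℂ^d`. -/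
def realPoints {d : ℕ} (W : Submodule ℂ (Fin d → ℂ)) : Submodule ℝ (Fin d → ℝ) where
  carrier := {v | (fun i => (v i : ℂ)) ∈ W}
  add_mem' := by
    intro v w hv hw
    have h := W.add_mem hv hw
    simpa [Pi.add_def] using h
  zero_mem' := by
    have h := W.zero_mem
    simpa [Pi.zero_def] using h
  smul_mem' := by
    intro c v hv
    have h := W.smul_mem (c : ℂ) hv
    simpa [Pi.smul_def] using h

/-- The real subspace contracted by `A`: the one corresponding to the eigenvalues of modulus less
than `1`, that is, the real points of the sum of their (full) generalized eigenspaces. -/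
def contractedSubspace {d : ℕ} (A : Matrix (Fin d) (Fin d) ℤ) : Submodule ℝ (Fin d → ℝ) :=
  realPoints (⨆ μ : ℂ, ⨆ _ : ‖μ‖ < 1, (complexEnd A).maxGenEigenspace μ)

/-- The sum of the (genuine, not generalized) eigenspaces of `A` for the eigenvalues of modulus
`1`, as a real subspace: the real points of the sum of the complex eigenspaces. -/
def centralEigenspace {d : ℕ} (A : Matrix (Fin d) (Fin d) ℤ) : Submodule ℝ (Fin d → ℝ) :=
  realPoints (⨆ μ : ℂ, ⨆ _ : ‖μ‖ = 1, (complexEnd A).eigenspace μ)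

/-- The Haar probability measure on the torus. -/
def torusHaar (d : ℕ) : Measure (UnitAddTorus (Fin d)) :=
  Measure.pi fun _ => AddCircle.haarAddCircle

instance (d : ℕ) : IsProbabilityMeasure (torusHaar d) := by
  unfold torusHaar; infer_instance

instance (d : ℕ) : (torusHaar d).IsAddHaarMeasure := by
  unfold torusHaar; infer_instance

/-- The set of points of the torus whose forward orbit under `A` equidistributes with respect to
the Haar probability measure. -/
def equidistributingPoints {d : ℕ} (A : Matrix (Fin d) (Fin d) ℤ) : Set (UnitAddTorus (Fin d)) :=
  {x | ∀ f : C(UnitAddTorus (Fin d), ℂ),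
    Tendsto (fun N : ℕ => (N : ℂ)⁻¹ * ∑ i ∈ Finset.range N, f ((toralMap A)^[i] x))
      atTop (𝓝 (∫ y, f y ∂torusHaar d))}

/-- The complement of the set of equidistributing points. -/
def nonEquidistributingPoints {d : ℕ} (A : Matrix (Fin d) (Fin d) ℤ) :
    Set (UnitAddTorus (Fin d)) :=
  (equidistributingPoints A)ᶜ

end

/-!
Write `Eq(A)` and `NEq(A)` for the equidistributing and the nonequidistributing points of `A`, and
`W_A` for the sum of its contracted subspace and its central eigenspaces. The proof
rests on three facts.

* Almost every point of the torus lies in `Eq(S)` (`ae_mem_equidistributingPoints`): distinct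
  iterates of a nontrivial character under a quasihyperbolic matrix are distinct characters, hence
  orthogonal.
* `Eq(A)` is invariant under translation by `W_A` (`add_torusProj_mem_equidistributingPoints`).
  Along the orbit of `v ∈ W_A` a character is the exponential of a bounded sequence which is a sum
  of rotations `n ↦ ζ ^ n` and of a null sequence, so it lies in the closed algebra generated by
  such sequences. Multiplication by a rotation does not spoil a Weyl sum with mean zero, by van der
  Corput's argument (`nullMean_rotation_mul`).
* By Kronecker's theorem `T` has an eigenvalue `μ` with `‖μ‖ > 1`. On the corresponding line or
  plane `P` (`ExpandingChart`) one coordinate of the `n`-th iterate is a linear form of size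
  `‖μ‖ ^ n`. The translates by `P` of any given point contain a set of dimension arbitrarily close
  to `dim P` on which that coordinate stays away from `0` along the whole orbit, and such points are
  not equidistributing for `T`. In quantitative form (`exists_avoiding_outside_cover`): such a point
  can be found outside every cover of small `s`-dimensional cost, `s < dim P`, by choosing nested
  cubes of smallest remaining cost among those that miss the forbidden slabs.

Since `W_S + W_T` is everything, `P` can be moved modulo `W_T` into `W_S`, by an injective linear map
`φ`, because nonzero vectors of `P` have unbounded orbits under `T` and those of `W_T` do not. For
almost every `x` all translates `x + φ z` lie in `Eq(S)`, while `x + φ z` lies in `NEq(T)` as soon as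
`x + z` does. So `Eq(S) ∩ NEq(T)` has slices of almost full dimension along the `φ`-image of `P`
through almost every point, with uniform constants. Integrating over `x` the cost of the part of a
cover that is visible from `x`, and bounding the measure of the tube around each member of the cover,
gives dimension `d` (`le_dimH_of_slices`).
-/

noncomputable section

open scoped Matrix ENNReal

/-! ### Toral endomorphisms and characters -/

/-- The covering map `ℝ^d → ℝ^d / ℤ^d`. -/
def torusProj {d : ℕ} (v : Fin d → ℝ) : UnitAddTorus (Fin d) := fun i => (v i : UnitAddCircle)

theorem torusProj_add {d : ℕ} (v w : Fin d → ℝ) :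
    torusProj (v + w) = torusProj v + torusProj w := by
  funext i; simp [torusProj]

theorem torusProj_sub {d : ℕ} (v w : Fin d → ℝ) :
    torusProj (v - w) = torusProj v - torusProj w := by
  funext i; simp [torusProj]

theorem toralMap_torusProj {d : ℕ} (A : Matrix (Fin d) (Fin d) ℤ) (v : Fin d → ℝ) :
    toralMap A (torusProj v) = torusProj ((A.map (Int.cast : ℤ → ℝ)) *ᵥ v) :=
  toralMap_coe A v

theorem toralMap_add {d : ℕ} (A : Matrix (Fin d) (Fin d) ℤ) (x y : UnitAddTorus (Fin d)) :
    toralMap A (x + y) = toralMap A x + toralMap A y := by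
  funext i
  simp [toralMap, Finset.sum_add_distrib]

theorem toralMap_mul {d : ℕ} (A B : Matrix (Fin d) (Fin d) ℤ) (x : UnitAddTorus (Fin d)) :
    toralMap (A * B) x = toralMap A (toralMap B x) := by
  funext i
  simp only [toralMap, Matrix.mul_apply, Finset.sum_smul, Finset.smul_sum, mul_smul]
  exact Finset.sum_comm

theorem toralMap_one {d : ℕ} (x : UnitAddTorus (Fin d)) :
    toralMap 1 x = x := by
  funext i
  simp [toralMap, Matrix.one_apply, ite_smul]

theorem toralMap_iterate {d : ℕ} (A : Matrix (Fin d) (Fin d) ℤ) (n : ℕ)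
    (x : UnitAddTorus (Fin d)) : (toralMap A)^[n] x = toralMap (A ^ n) x := by
  induction n generalizing x with
  | zero => simp [toralMap_one]
  | succ n ih => rw [Function.iterate_succ_apply, ih, pow_succ, toralMap_mul]

theorem mFourier_eq_toCircle {d : ℕ} (m : Fin d → ℤ) (x : UnitAddTorus (Fin d)) :
    UnitAddTorus.mFourier m x = (AddCircle.toCircle (∑ i, m i • x i) : ℂ) := by
  have key : ∀ s : Finset (Fin d), ∏ i ∈ s, fourier (m i) (x i) =
      (AddCircle.toCircle (∑ i ∈ s, m i • x i) : ℂ) := by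
    intro s
    induction s using Finset.cons_induction with
    | empty => simp
    | cons a s ha ih => rw [Finset.prod_cons, Finset.sum_cons, ih, AddCircle.toCircle_add]; rfl
  exact key Finset.univ

theorem mFourier_add_apply {d : ℕ} (m : Fin d → ℤ) (x y : UnitAddTorus (Fin d)) :
    UnitAddTorus.mFourier m (x + y) = UnitAddTorus.mFourier m x * UnitAddTorus.mFourier m y := by
  simp only [mFourier_eq_toCircle, Pi.add_apply, smul_add, Finset.sum_add_distrib,
    AddCircle.toCircle_add, Circle.coe_mul]

theorem norm_mFourier_apply {d : ℕ} (m : Fin d → ℤ) (x : UnitAddTorus (Fin d)) :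
    ‖UnitAddTorus.mFourier m x‖ = 1 := by
  rw [mFourier_eq_toCircle, Circle.norm_coe]

theorem mFourier_toralMap {d : ℕ} (A : Matrix (Fin d) (Fin d) ℤ) (m : Fin d → ℤ)
    (x : UnitAddTorus (Fin d)) :
    UnitAddTorus.mFourier m (toralMap A x) = UnitAddTorus.mFourier (Aᵀ *ᵥ m) x := by
  rw [mFourier_eq_toCircle, mFourier_eq_toCircle]
  congr 2
  simp only [toralMap, Matrix.mulVec, dotProduct, Matrix.transpose_apply, Finset.smul_sum,
    Finset.sum_smul, mul_smul]
  rw [Finset.sum_comm]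
  refine Finset.sum_congr rfl fun j _ => Finset.sum_congr rfl fun i _ => ?_
  rw [smul_smul, smul_smul, mul_comm]

theorem mFourier_iterate {d : ℕ} (A : Matrix (Fin d) (Fin d) ℤ) (m : Fin d → ℤ) (n : ℕ)
    (x : UnitAddTorus (Fin d)) :
    UnitAddTorus.mFourier m ((toralMap A)^[n] x) =
      UnitAddTorus.mFourier ((Aᵀ ^ n) *ᵥ m) x := by
  rw [toralMap_iterate, mFourier_toralMap, Matrix.transpose_pow]

theorem mFourier_mul_conj {d : ℕ} (m m' : Fin d → ℤ) (x : UnitAddTorus (Fin d)) :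
    UnitAddTorus.mFourier m x * (starRingEnd ℂ) (UnitAddTorus.mFourier m' x) =
      UnitAddTorus.mFourier (m - m') x := by
  rw [← UnitAddTorus.mFourier_neg, ← UnitAddTorus.mFourier_add, sub_eq_add_neg]

theorem mFourier_torusProj {d : ℕ} (m : Fin d → ℤ) (v : Fin d → ℝ) :
    UnitAddTorus.mFourier m (torusProj v) =
      Complex.exp (2 * Real.pi * Complex.I * ∑ i, (m i : ℂ) * (v i : ℂ)) := by
  have : ∀ i, fourier (m i) (torusProj v i) =
      Complex.exp (2 * Real.pi * Complex.I * ((m i : ℂ) * (v i : ℂ))) := by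
    intro i
    rw [torusProj, fourier_coe_apply]
    congr 1
    push_cast
    ring
  change ∏ i, fourier (m i) (torusProj v i) = _
  simp only [this, ← Complex.exp_sum, Finset.mul_sum]

theorem integrable_continuousMap {d : ℕ} (g : C(UnitAddTorus (Fin d), ℂ)) :
    Integrable g (torusHaar d) :=
  g.continuous.integrable_of_hasCompactSupport (HasCompactSupport.of_compactSpace _)

theorem integral_mFourier {d : ℕ} {m : Fin d → ℤ} (hm : m ≠ 0) :
    ∫ y, UnitAddTorus.mFourier m y ∂torusHaar d = 0 := by
  obtain ⟨i, hi⟩ := Function.ne_iff.mp hm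
  have h : ∫ y, UnitAddTorus.mFourier m y ∂torusHaar d =
      ∏ i, ∫ t, fourier (m i) t ∂(AddCircle.haarAddCircle (T := (1 : ℝ))) :=
    integral_fintype_prod_eq_prod (μ := fun _ => AddCircle.haarAddCircle (T := (1 : ℝ)))
      (fun i (t : UnitAddCircle) => (fourier (m i) t : ℂ))
  rw [h]
  refine Finset.prod_eq_zero (Finset.mem_univ i) ?_
  exact integral_eq_zero_of_add_right_eq_neg (fourier_add_half_inv_index hi one_pos)

/-! ### Weyl's criterion -/

/-- The sequence `u` has Cesàro means tending to `0`. -/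
def NullMean (u : ℕ → ℂ) : Prop :=
  Tendsto (fun N : ℕ => (N : ℂ)⁻¹ * ∑ i ∈ Finset.range N, u i) atTop (𝓝 0)

theorem tendsto_of_forall_approx {u : ℕ → ℂ} {l : ℂ}
    (h : ∀ ε > 0, ∃ v : ℕ → ℂ, ∃ l' : ℂ, Tendsto v atTop (𝓝 l') ∧ ‖l' - l‖ ≤ ε ∧
      ∀ N, ‖u N - v N‖ ≤ ε) : Tendsto u atTop (𝓝 l) := by
  rw [Metric.tendsto_atTop]
  intro ε hε
  obtain ⟨v, l', hv, hl, huv⟩ := h (ε / 4) (by positivity)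
  obtain ⟨N, hN⟩ := Metric.tendsto_atTop.mp hv (ε / 4) (by positivity)
  refine ⟨N, fun n hn => ?_⟩
  have h1 := hN n hn
  rw [dist_eq_norm] at h1 ⊢
  have h2 : u n - l = (u n - v n) + (v n - l') + (l' - l) := by ring
  calc ‖u n - l‖ ≤ ‖u n - v n‖ + ‖v n - l'‖ + ‖l' - l‖ := by rw [h2]; exact norm_add₃_le
    _ < ε := by linarith [huv n]

theorem norm_cesaro_le {u : ℕ → ℂ} {C : ℝ} (h : ∀ n, ‖u n‖ ≤ C) (N : ℕ) :
    ‖(N : ℂ)⁻¹ * ∑ i ∈ Finset.range N, u i‖ ≤ C := by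
  have hC : 0 ≤ C := (norm_nonneg _).trans (h 0)
  rcases Nat.eq_zero_or_pos N with rfl | hN
  · simpa using hC
  have h1 : ‖∑ i ∈ Finset.range N, u i‖ ≤ N * C := by
    refine (norm_sum_le_of_le _ fun i _ => h i).trans ?_
    simp
  rw [norm_mul, norm_inv, Complex.norm_natCast, inv_mul_le_iff₀ (by exact_mod_cast hN)]
  exact h1

theorem cesaro_sub (u v : ℕ → ℂ) (N : ℕ) :
    (N : ℂ)⁻¹ * ∑ i ∈ Finset.range N, u i - (N : ℂ)⁻¹ * ∑ i ∈ Finset.range N, v i =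
      (N : ℂ)⁻¹ * ∑ i ∈ Finset.range N, (u i - v i) := by
  rw [Finset.sum_sub_distrib, mul_sub]

/-- Weyl's criterion for equidistribution on the torus. -/
theorem mem_equidistributingPoints_iff {d : ℕ} {A : Matrix (Fin d) (Fin d) ℤ}
    {x : UnitAddTorus (Fin d)} :
    x ∈ equidistributingPoints A ↔
      ∀ m : Fin d → ℤ, m ≠ 0 →
        NullMean fun n => UnitAddTorus.mFourier m ((toralMap A)^[n] x) := by
  refine ⟨fun hx m hm => ?_, fun hx f => ?_⟩
  · have := hx (UnitAddTorus.mFourier m)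
    rwa [integral_mFourier hm] at this
  · have hspan : ∀ g ∈ Submodule.span ℂ (Set.range (UnitAddTorus.mFourier (d := Fin d))),
        Tendsto (fun N : ℕ => (N : ℂ)⁻¹ * ∑ i ∈ Finset.range N, g ((toralMap A)^[i] x))
          atTop (𝓝 (∫ y, g y ∂torusHaar d)) := by
      intro g hg
      induction hg using Submodule.span_induction with
      | mem g hg =>
        obtain ⟨m, rfl⟩ := hg
        by_cases hm : m = 0
        · subst hm
          simp only [UnitAddTorus.mFourier_zero, ContinuousMap.one_apply, Finset.sum_const,
            Finset.card_range, nsmul_eq_mul, mul_one, integral_const, probReal_univ, one_smul]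
          refine tendsto_const_nhds.congr' ?_
          filter_upwards [eventually_gt_atTop 0] with N hN
          rw [inv_mul_cancel₀ (by exact_mod_cast hN.ne')]
        · rw [integral_mFourier hm]
          exact hx m hm
      | zero => simp
      | add g h _ _ ihg ihh =>
        simp only [ContinuousMap.add_apply, Finset.sum_add_distrib, mul_add]
        rw [integral_add (integrable_continuousMap g) (integrable_continuousMap h)]
        exact ihg.add ihh
      | smul c g _ ih =>
        simp only [ContinuousMap.smul_apply, smul_eq_mul, ← Finset.mul_sum]
        rw [integral_const_mul]
        refine (ih.const_mul c).congr fun N => by ring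
    refine tendsto_of_forall_approx fun ε hε => ?_
    have hf : f ∈ (Submodule.span ℂ
        (Set.range (UnitAddTorus.mFourier (d := Fin d)))).topologicalClosure := by
      rw [UnitAddTorus.span_mFourier_closure_eq_top]; trivial
    obtain ⟨g, hg, hfg⟩ := Metric.mem_closure_iff.mp hf ε hε
    have hfg' : ∀ y, ‖f y - g y‖ ≤ ε := fun y => by
      rw [← dist_eq_norm]; exact (ContinuousMap.dist_apply_le_dist y).trans hfg.le
    refine ⟨_, _, hspan g hg, ?_, fun N => ?_⟩
    · have hint : ∀ g : C(UnitAddTorus (Fin d), ℂ), Integrable g (torusHaar d) := fun g =>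
        g.continuous.integrable_of_hasCompactSupport (HasCompactSupport.of_compactSpace _)
      rw [← integral_sub (integrable_continuousMap g) (integrable_continuousMap f)]
      refine (norm_integral_le_of_norm_le_const (C := ε)
        (Eventually.of_forall fun y => ?_)).trans (by simp)
      rw [norm_sub_rev]; exact hfg' y
    · rw [cesaro_sub]
      exact norm_cesaro_le (fun n => hfg' _) N

/-! ### Eigenvalues of quasihyperbolic matrices -/

theorem hasEigenvalue_complexEnd_iff {d : ℕ} {A : Matrix (Fin d) (Fin d) ℤ} {μ : ℂ} :
    (complexEnd A).HasEigenvalue μ ↔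
      ((A.charpoly).map (Int.castRingHom ℂ)).IsRoot μ := by
  rw [Module.End.hasEigenvalue_iff_isRoot_charpoly, complexEnd, ← Matrix.charpoly_map]
  rw [Matrix.charpoly_toLin']
  rfl

theorem complexEnd_pow {d : ℕ} (A : Matrix (Fin d) (Fin d) ℤ) (n : ℕ) :
    complexEnd (A ^ n) = (complexEnd A) ^ n := by
  rw [complexEnd, complexEnd, ← Matrix.toLin'_pow]
  congr 1
  exact Matrix.map_pow A (Int.castRingHom ℂ) n

/-- The iterates of a nontrivial character are pairwise distinct. -/
theorem transpose_pow_mulVec_injective {d : ℕ} {A : Matrix (Fin d) (Fin d) ℤ}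
    (hA : IsQuasihyperbolic A) {m : Fin d → ℤ} (hm : m ≠ 0) :
    Function.Injective fun n : ℕ => (Aᵀ ^ n) *ᵥ m := by
  -- a coincidence `(Aᵀ)^(n+p) m = (Aᵀ)^n m` makes `1` an eigenvalue of `A ^ p`
  have key : ∀ n p : ℕ, 0 < p → (Aᵀ ^ (n + p)) *ᵥ m ≠ (Aᵀ ^ n) *ᵥ m := by
    intro n p hp h
    have hdet : (Aᵀ ^ n).det ≠ 0 := by
      rw [Matrix.det_pow, Matrix.det_transpose]; exact pow_ne_zero _ hA.1
    have h1 : (Aᵀ ^ p - 1) *ᵥ m = 0 := by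
      apply Matrix.eq_zero_of_mulVec_eq_zero hdet
      rw [Matrix.mulVec_mulVec, mul_sub, ← pow_add, mul_one, Matrix.sub_mulVec, h, sub_self]
    have h2 : (A ^ p - 1).det = 0 := by
      rw [← Matrix.det_transpose, Matrix.transpose_sub, Matrix.transpose_pow,
        Matrix.transpose_one]
      exact Matrix.exists_mulVec_eq_zero_iff.mp ⟨m, hm, h1⟩
    have h3 : (complexEnd (A ^ p)).HasEigenvalue 1 := by
      rw [hasEigenvalue_complexEnd_iff, Polynomial.IsRoot, ← Int.cast_one, ← eq_intCast
        (Int.castRingHom ℂ) 1, Polynomial.eval_map_apply, Matrix.eval_charpoly]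
      rw [← neg_sub, Matrix.det_neg] at h2
      simpa using h2
    rw [complexEnd_pow] at h3
    obtain ⟨μ, hμ, hμp⟩ : ∃ μ, (complexEnd A).HasEigenvalue μ ∧ μ ^ p = 1 := by
      have h5 := h3.mem_spectrum
      rw [spectrum.map_pow_of_pos _ hp] at h5
      obtain ⟨μ, hμ, hμ'⟩ := h5
      exact ⟨μ, Module.End.hasEigenvalue_iff_mem_spectrum.mpr hμ, hμ'⟩
    exact hA.2 μ hμ p hp hμp
  intro a b hab
  rcases lt_trichotomy a b with h | h | h
  · obtain ⟨p, rfl⟩ := Nat.exists_eq_add_of_lt h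
    exact absurd hab.symm (key a (p + 1) (by omega))
  · exact h
  · obtain ⟨p, rfl⟩ := Nat.exists_eq_add_of_lt h
    exact absurd hab (key b (p + 1) (by omega))

/-- Kronecker's theorem: the eigenvalues are algebraic integers, so if none had modulus greater
than one then they would all be roots of unity. -/
theorem exists_eigenvalue_one_lt_norm {d : ℕ} (hd : d ≠ 0) {A : Matrix (Fin d) (Fin d) ℤ}
    (hA : IsQuasihyperbolic A) :
    ∃ μ : ℂ, 1 < ‖μ‖ ∧ (complexEnd A).HasEigenvalue μ := by
  by_contra! hcon
  have hmonic : (A.charpoly.map (Int.castRingHom ℂ)).Monic := (Matrix.charpoly_monic A).map _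
  have : Nonempty (Fin d) := ⟨⟨0, Nat.pos_of_ne_zero hd⟩⟩
  have : Nontrivial (Fin d → ℂ) := inferInstance
  obtain ⟨z, hz⟩ := Module.End.exists_eigenvalue (complexEnd A)
  have hroot := hasEigenvalue_complexEnd_iff.mp hz
  have hM : (A.charpoly.map (Int.castRingHom ℂ)).mahlerMeasure = 1 := by
    rw [Polynomial.mahlerMeasure_eq_leadingCoeff_mul_prod_roots, hmonic.leadingCoeff, norm_one,
      one_mul]
    refine Multiset.prod_eq_one fun y hy => ?_
    obtain ⟨a, ha, rfl⟩ := Multiset.mem_map.mp hy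
    refine max_eq_left (not_lt.mp fun h => hcon a h ?_)
    exact hasEigenvalue_complexEnd_iff.mpr (Polynomial.isRoot_of_mem_roots ha)
  have hz0 : z ≠ 0 := by
    rintro rfl
    apply hA.1
    rw [Matrix.det_eq_sign_charpoly_coeff, Polynomial.coeff_zero_eq_eval_zero]
    rw [Polynomial.IsRoot, ← Int.cast_zero, ← eq_intCast (Int.castRingHom ℂ) 0,
        Polynomial.eval_map_apply] at hroot
    rw [(Int.castRingHom ℂ).injective_int hroot, mul_zero]
  obtain ⟨n, hn, hzn⟩ := Polynomial.pow_eq_one_of_mahlerMeasure_eq_one hM hz0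
    ((Polynomial.mem_roots hmonic.ne_zero).mpr hroot)
  exact hA.2 z hz n hn hzn

/-! ### Almost every point equidistributes -/

/-- For a bounded sequence it suffices to know the Cesàro means along the squares. -/
theorem nullMean_of_tendsto_sq {u : ℕ → ℂ} (hu : ∀ n, ‖u n‖ ≤ 1)
    (h : Tendsto (fun k : ℕ => ((k ^ 2 : ℕ) : ℂ)⁻¹ * ∑ i ∈ Finset.range (k ^ 2), u i)
      atTop (𝓝 0)) : NullMean u := by
  have hsqrt : Tendsto Nat.sqrt atTop atTop :=
    tendsto_atTop_atTop.mpr fun b => ⟨b ^ 2, fun a ha => Nat.le_sqrt'.mpr ha⟩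
  have h1 := (h.comp hsqrt).norm
  have h2 : Tendsto (fun N : ℕ => 2 / (Nat.sqrt N : ℝ)) atTop (𝓝 0) :=
    (tendsto_const_div_atTop_nhds_zero_nat 2).comp hsqrt
  have h3 := h1.add h2
  rw [norm_zero, add_zero] at h3
  refine squeeze_zero_norm' ?_ h3
  filter_upwards [eventually_gt_atTop 0] with N hN
  simp only [Function.comp_apply]
  set k := Nat.sqrt N with hk
  have hk0 : 0 < k := Nat.sqrt_pos.mpr hN
  have hkN : k ^ 2 ≤ N := Nat.sqrt_le' N
  have hNk : N ≤ k ^ 2 + 2 * k := by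
    have := Nat.lt_succ_sqrt' N
    rw [← hk, Nat.succ_eq_add_one] at this
    nlinarith
  clear_value k
  obtain ⟨r, rfl⟩ := Nat.exists_eq_add_of_le hkN
  have hr : (r : ℝ) ≤ 2 * k := by exact_mod_cast (by omega : r ≤ 2 * k)
  have hkR : (0 : ℝ) < k := by exact_mod_cast hk0
  have hsq : (0 : ℝ) < (k : ℝ) ^ 2 := by positivity
  rw [Finset.sum_range_add, norm_mul, norm_inv, Complex.norm_natCast,
    norm_mul, norm_inv, Complex.norm_natCast]
  have hA : ‖∑ i ∈ Finset.range r, u (k ^ 2 + i)‖ ≤ r := by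
    refine (norm_sum_le_of_le _ fun i _ => hu _).trans ?_
    simp
  set X := ‖∑ i ∈ Finset.range (k ^ 2), u i‖ with hX
  have hX0 : 0 ≤ X := norm_nonneg _
  have hinv : (((k ^ 2 + r : ℕ) : ℝ))⁻¹ ≤ (((k ^ 2 : ℕ) : ℝ))⁻¹ := by
    apply inv_anti₀
    · exact_mod_cast (by positivity : 0 < k ^ 2)
    · exact_mod_cast Nat.le_add_right _ _
  calc (((k ^ 2 + r : ℕ) : ℝ))⁻¹ * ‖∑ i ∈ Finset.range (k ^ 2), u i +
        ∑ i ∈ Finset.range r, u (k ^ 2 + i)‖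
      ≤ (((k ^ 2 : ℕ) : ℝ))⁻¹ * (X + 2 * k) := by
        gcongr
        exact (norm_add_le _ _).trans (add_le_add le_rfl (hA.trans hr))
    _ = (((k ^ 2 : ℕ) : ℝ))⁻¹ * X + 2 / (k : ℝ) := by
        push_cast
        field_simp

theorem integral_norm_sum_mFourier_sq {d : ℕ} {M : ℕ → Fin d → ℤ} (hM : Function.Injective M)
    (N : ℕ) :
    ∫ x, ‖∑ i ∈ Finset.range N, UnitAddTorus.mFourier (M i) x‖ ^ 2 ∂torusHaar d = N := by
  have h1 : ∀ x : UnitAddTorus (Fin d),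
      ((‖∑ i ∈ Finset.range N, UnitAddTorus.mFourier (M i) x‖ ^ 2 : ℝ) : ℂ) =
      ∑ i ∈ Finset.range N, ∑ j ∈ Finset.range N, UnitAddTorus.mFourier (M i - M j) x := by
    intro x
    rw [Complex.ofReal_pow, ← Complex.mul_conj', map_sum, Finset.sum_mul_sum]
    exact Finset.sum_congr rfl fun i _ => Finset.sum_congr rfl fun j _ => mFourier_mul_conj _ _ _
  have h2 : ∀ i j, ∫ x, UnitAddTorus.mFourier (M i - M j) x ∂torusHaar d =
      if i = j then 1 else 0 := by
    intro i j
    split_ifs with h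
    · subst h
      simp [UnitAddTorus.mFourier_zero]
    · exact integral_mFourier (sub_ne_zero.mpr fun h' => h (hM h'))
  have h3 : ((∫ x, ‖∑ i ∈ Finset.range N, UnitAddTorus.mFourier (M i) x‖ ^ 2 ∂torusHaar d : ℝ) : ℂ)
      = (N : ℝ) := by
    rw [← integral_complex_ofReal]
    simp only [h1]
    rw [integral_finsetSum _ fun i _ => integrable_finsetSum _ fun j _ =>
      integrable_continuousMap _]
    simp only [integral_finsetSum _ fun j _ => integrable_continuousMap _, h2]
    simp only [Finset.sum_ite_eq, Finset.mem_range]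
    rw [Finset.sum_congr rfl fun i hi => if_pos (Finset.mem_range.mp hi)]
    simp
  exact_mod_cast h3

/-- The means of `N` distinct characters have squared `L²` norm `1 / N`, which is summable along
`N = k ^ 2`. -/
theorem ae_nullMean_mFourier {d : ℕ} {M : ℕ → Fin d → ℤ} (hM : Function.Injective M) :
    ∀ᵐ x ∂torusHaar d, NullMean fun n => UnitAddTorus.mFourier (M n) x := by
  set a : ℕ → UnitAddTorus (Fin d) → ℂ := fun k x =>
    ((k ^ 2 : ℕ) : ℂ)⁻¹ * ∑ i ∈ Finset.range (k ^ 2), UnitAddTorus.mFourier (M i) x with ha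
  have hac : ∀ k, Continuous (a k) := fun k => by simp only [ha]; fun_prop
  have hint : ∀ k, ∫⁻ x, ENNReal.ofReal (‖a k x‖ ^ 2) ∂torusHaar d =
      ENNReal.ofReal (((k : ℝ) ^ 2)⁻¹) := by
    intro k
    rw [← ofReal_integral_eq_lintegral_ofReal]
    · congr 1
      simp only [ha, norm_mul, mul_pow]
      rw [integral_const_mul, integral_norm_sum_mFourier_sq hM]
      rcases Nat.eq_zero_or_pos k with rfl | hk
      · simp
      · have : (k : ℝ) ≠ 0 := by exact_mod_cast hk.ne'
        simp only [norm_inv, Complex.norm_natCast]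
        push_cast
        field_simp
    · exact ((hac k).norm.pow 2).integrable_of_hasCompactSupport
        (HasCompactSupport.of_compactSpace _)
    · exact Eventually.of_forall fun x => by positivity
  have hsum : ∑' k, ∫⁻ x, ENNReal.ofReal (‖a k x‖ ^ 2) ∂torusHaar d ≠ ∞ := by
    simp only [hint]
    have hs : Summable fun k : ℕ => ((k : ℝ) ^ 2)⁻¹ := Real.summable_nat_pow_inv.mpr one_lt_two
    rw [← ENNReal.ofReal_tsum_of_nonneg (fun k => by positivity) hs]
    exact ENNReal.ofReal_ne_top
  have hmeas : ∀ k, Measurable fun x => ENNReal.ofReal (‖a k x‖ ^ 2) := fun k =>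
    ((hac k).norm.pow 2).measurable.ennreal_ofReal
  rw [← lintegral_tsum fun k => (hmeas k).aemeasurable] at hsum
  filter_upwards [ae_lt_top (Measurable.tsum hmeas) hsum] with x hx
  refine nullMean_of_tendsto_sq (fun n => (norm_mFourier_apply _ _).le) ?_
  have h1 := ENNReal.tendsto_atTop_zero_of_tsum_ne_top hx.ne
  have h2 : Tendsto (fun k => ‖a k x‖ ^ 2) atTop (𝓝 0) := by
    have := (ENNReal.tendsto_toReal ENNReal.zero_ne_top).comp h1
    refine this.congr fun k => ?_
    exact ENNReal.toReal_ofReal (by positivity)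
  have h3 : Tendsto (fun k => ‖a k x‖) atTop (𝓝 0) := by
    have := h2.sqrt
    simpa using this
  exact tendsto_zero_iff_norm_tendsto_zero.mpr h3

theorem ae_mem_equidistributingPoints {d : ℕ} {A : Matrix (Fin d) (Fin d) ℤ}
    (hA : IsQuasihyperbolic A) : ∀ᵐ x ∂torusHaar d, x ∈ equidistributingPoints A := by
  have h : ∀ᵐ x ∂torusHaar d, ∀ m : Fin d → ℤ, m ≠ 0 →
      NullMean fun n => UnitAddTorus.mFourier m ((toralMap A)^[n] x) := by
    refine ae_all_iff.mpr fun m => ?_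
    by_cases hm : m = 0
    · exact Eventually.of_forall fun x h => absurd hm h
    · filter_upwards [ae_nullMean_mFourier (transpose_pow_mulVec_injective hA hm)] with x hx _
      simpa only [mFourier_iterate] using hx
  filter_upwards [h] with x hx
  exact mem_equidistributingPoints_iff.mpr hx

/-! ### Twisted averages along equidistributing orbits -/

theorem norm_sum_shift_sub_le {u : ℕ → ℂ} (hu : ∀ n, ‖u n‖ = 1) (h N : ℕ) :
    ‖∑ i ∈ Finset.range N, u (i + h) - ∑ i ∈ Finset.range N, u i‖ ≤ 2 * h := by
  have e1 : ∑ i ∈ Finset.range (N + h), u i =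
      ∑ i ∈ Finset.range N, u i + ∑ i ∈ Finset.range h, u (N + i) := Finset.sum_range_add _ _ _
  have e2 : ∑ i ∈ Finset.range (h + N), u i =
      ∑ i ∈ Finset.range h, u i + ∑ i ∈ Finset.range N, u (h + i) := Finset.sum_range_add _ _ _
  rw [add_comm h N] at e2
  have e3 : ∑ i ∈ Finset.range N, u (i + h) - ∑ i ∈ Finset.range N, u i =
      ∑ i ∈ Finset.range h, u (N + i) - ∑ i ∈ Finset.range h, u i := by
    simp only [add_comm _ h]
    linear_combination e1 - e2
  have b : ∀ v : ℕ → ℂ, (∀ n, ‖v n‖ = 1) → ‖∑ i ∈ Finset.range h, v i‖ ≤ h := fun v hv => by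
    refine (norm_sum_le_of_le _ fun i _ => (hv i).le).trans ?_
    simp
  rw [e3]
  calc _ ≤ ‖∑ i ∈ Finset.range h, u (N + i)‖ + ‖∑ i ∈ Finset.range h, u i‖ := norm_sub_le _ _
    _ ≤ h + h := add_le_add (b _ fun n => hu _) (b _ hu)
    _ = 2 * h := by ring

/-- Van der Corput's inequality in its qualitative form: a unimodular sequence that is
uncorrelated with its shifts has mean zero. -/
theorem nullMean_of_correlations {u : ℕ → ℂ} (hu : ∀ n, ‖u n‖ = 1)
    (hcor : ∀ h h' : ℕ, h ≠ h' →
      NullMean fun n => u (n + h) * (starRingEnd ℂ) (u (n + h'))) : NullMean u := by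
  rw [NullMean, Metric.tendsto_atTop]
  intro ε hε
  -- the average over a window of length `H` has mean square tending to `1 / H`
  obtain ⟨H, hH⟩ := exists_nat_gt (4 / ε ^ 2 * 2)
  have hH0 : (0 : ℝ) < H := lt_of_le_of_lt (by positivity) hH
  set W : ℕ → ℂ := fun N => (N : ℂ)⁻¹ * ∑ n ∈ Finset.range N,
    (∑ h ∈ Finset.range H, u (n + h)) * (starRingEnd ℂ) (∑ h ∈ Finset.range H, u (n + h)) with hW
  have hWlim : Tendsto W atTop (𝓝 H) := by
    have h1 : ∀ N, W N = ∑ h ∈ Finset.range H, ∑ h' ∈ Finset.range H, (N : ℂ)⁻¹ *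
        ∑ n ∈ Finset.range N, u (n + h) * (starRingEnd ℂ) (u (n + h')) := by
      intro N
      simp only [hW, map_sum, Finset.sum_mul_sum]
      simp only [Finset.mul_sum]
      rw [Finset.sum_comm]
      exact Finset.sum_congr rfl fun i _ => Finset.sum_comm
    have h2 : Tendsto (fun N : ℕ => ∑ h ∈ Finset.range H, ∑ h' ∈ Finset.range H, (N : ℂ)⁻¹ *
        ∑ n ∈ Finset.range N, u (n + h) * (starRingEnd ℂ) (u (n + h'))) atTop
        (𝓝 (∑ h ∈ Finset.range H, ∑ h' ∈ Finset.range H, if h = h' then 1 else 0)) := by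
      refine tendsto_finsetSum _ fun h _ => tendsto_finsetSum _ fun h' _ => ?_
      split_ifs with hh
      · subst hh
        refine tendsto_const_nhds.congr' ?_
        filter_upwards [eventually_gt_atTop 0] with N hN
        have : ∀ n, u (n + h) * (starRingEnd ℂ) (u (n + h)) = 1 := fun n => by
          rw [Complex.mul_conj', hu]; simp
        simp only [this, Finset.sum_const, Finset.card_range, nsmul_eq_mul, mul_one]
        rw [inv_mul_cancel₀ (by exact_mod_cast hN.ne')]
      · exact hcor h h' hh
    have h3 : (∑ h ∈ Finset.range H, ∑ h' ∈ Finset.range H, if h = h' then (1 : ℂ) else 0) = H := by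
      simp only [Finset.sum_ite_eq]
      rw [Finset.sum_congr rfl fun i hi => if_pos hi]
      simp
    rw [h3] at h2
    exact h2.congr fun N => (h1 N).symm
  have hWn : Tendsto (fun N => ‖W N‖) atTop (𝓝 (H : ℝ)) := by
    have := hWlim.norm
    rwa [Complex.norm_natCast] at this
  have hev := hWn.eventually (gt_mem_nhds (show (H : ℝ) < 2 * H by linarith))
  obtain ⟨N₁, hN₁⟩ := eventually_atTop.mp hev
  obtain ⟨N₂, hN₂⟩ := exists_nat_gt (4 * H / ε)
  refine ⟨max N₁ (max N₂ 1), fun N hN => ?_⟩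
  have hNN₁ : N₁ ≤ N := (le_max_left _ _).trans hN
  have hNN₂ : N₂ ≤ N := (le_max_left _ _).trans ((le_max_right _ _).trans hN)
  have hN1 : 1 ≤ N := (le_max_right _ _).trans ((le_max_right _ _).trans hN)
  have hN0 : (0 : ℝ) < N := by exact_mod_cast hN1
  have hW2 : ‖W N‖ < 2 * H := hN₁ N hNN₁
  have hN2 : 4 * H / ε < N := hN₂.trans_le (by exact_mod_cast hNN₂)
  -- Cauchy–Schwarz for the averaged sequence
  set w : ℕ → ℂ := fun n => ∑ h ∈ Finset.range H, u (n + h) with hw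
  have hWw : ‖W N‖ = (N : ℝ)⁻¹ * ∑ n ∈ Finset.range N, ‖w n‖ ^ 2 := by
    have : W N = (((N : ℝ)⁻¹ * ∑ n ∈ Finset.range N, ‖w n‖ ^ 2 : ℝ) : ℂ) := by
      simp only [hW, Complex.mul_conj']
      push_cast
      rfl
    rw [this, Complex.norm_real, Real.norm_of_nonneg (by positivity)]
  have hCS : ‖∑ n ∈ Finset.range N, w n‖ ^ 2 ≤ N * ∑ n ∈ Finset.range N, ‖w n‖ ^ 2 := by
    have h1 : ‖∑ n ∈ Finset.range N, w n‖ ≤ ∑ n ∈ Finset.range N, ‖w n‖ := norm_sum_le _ _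
    calc _ ≤ (∑ n ∈ Finset.range N, ‖w n‖) ^ 2 := by gcongr
      _ ≤ _ := by simpa using sq_sum_le_card_mul_sum_sq (s := Finset.range N) (f := fun n => ‖w n‖)
  have hshift : ‖∑ n ∈ Finset.range N, w n - H * ∑ n ∈ Finset.range N, u n‖ ≤ 2 * H * H := by
    have : ∑ n ∈ Finset.range N, w n - H * ∑ n ∈ Finset.range N, u n =
        ∑ h ∈ Finset.range H,
          (∑ n ∈ Finset.range N, u (n + h) - ∑ n ∈ Finset.range N, u n) := by
      rw [Finset.sum_sub_distrib, Finset.sum_comm]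
      simp
    rw [this]
    refine (norm_sum_le_of_le (f := fun h =>
      (∑ n ∈ Finset.range N, u (n + h) - ∑ n ∈ Finset.range N, u n)) (n := fun _ => 2 * (H : ℝ))
      _ fun h hh => ?_).trans (by simp; linarith)
    refine (norm_sum_shift_sub_le hu h N).trans ?_
    have : (h : ℝ) ≤ H := by exact_mod_cast (Finset.mem_range.mp hh).le
    linarith
  set X := ‖∑ n ∈ Finset.range N, u n‖ with hX
  set Y := ‖∑ n ∈ Finset.range N, w n‖ with hY
  set Z := ∑ n ∈ Finset.range N, ‖w n‖ ^ 2 with hZ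
  have hHX : H * X ≤ Y + 2 * H * H := by
    have h1 : H * X = ‖(H : ℂ) * ∑ n ∈ Finset.range N, u n‖ := by
      rw [norm_mul, Complex.norm_natCast]
    have h2 := norm_sub_norm_le ((H : ℂ) * ∑ n ∈ Finset.range N, u n) (∑ n ∈ Finset.range N, w n)
    rw [norm_sub_rev, ← h1] at h2
    linarith
  have hZ2 : Z < 2 * H * N := by
    rw [hWw] at hW2
    rw [inv_mul_lt_iff₀ hN0] at hW2
    linarith
  have hYb : Y < ε / 2 * H * N := by
    refine lt_of_pow_lt_pow_left₀ 2 (by positivity) ?_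
    have h1 : Y ^ 2 < N * (2 * H * N) := lt_of_le_of_lt hCS (by gcongr)
    have h2 : 8 < ε ^ 2 * H := by
      rw [div_mul_eq_mul_div, div_lt_iff₀ (by positivity)] at hH
      linarith
    have h3 : 2 * (H * (N : ℝ) ^ 2) * 4 ≤ ε ^ 2 * H * (H * N ^ 2) := by
      nlinarith [mul_pos hH0 (pow_pos hN0 2)]
    nlinarith
  have hfin : X < ε * N := by
    have h1 : 4 * H < ε * N := by
      rw [div_lt_iff₀ hε] at hN2; linarith
    have h2 : H * X < H * (ε * N) := by nlinarith
    exact lt_of_mul_lt_mul_left h2 hH0.le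
  rw [dist_zero_right, norm_mul, norm_inv, Complex.norm_natCast, inv_mul_lt_iff₀ hN0]
  linarith

theorem NullMean.of_tendsto_zero {u : ℕ → ℂ} (hu : Tendsto u atTop (𝓝 0)) : NullMean u := by
  have := hu.cesaro_smul
  refine this.congr fun N => ?_
  rw [← Complex.coe_smul, smul_eq_mul]
  push_cast
  rfl

/-- The orbit of an equidistributing point is disjoint from every rotation: Weyl sums twisted by a
rotation still have mean zero. -/
theorem nullMean_rotation_mul {d : ℕ} {A : Matrix (Fin d) (Fin d) ℤ} (hA : IsQuasihyperbolic A)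
    {x : UnitAddTorus (Fin d)} (hx : x ∈ equidistributingPoints A) {ζ : ℂ} (hζ : ‖ζ‖ = 1)
    {m : Fin d → ℤ} (hm : m ≠ 0) :
    NullMean fun n => ζ ^ n * UnitAddTorus.mFourier m ((toralMap A)^[n] x) := by
  refine nullMean_of_correlations (fun n => by
    rw [norm_mul, norm_pow, hζ, one_pow, one_mul, norm_mFourier_apply]) fun h h' hh => ?_
  have hne : (Aᵀ ^ h) *ᵥ m - (Aᵀ ^ h') *ᵥ m ≠ 0 :=
    sub_ne_zero.mpr fun e => hh (transpose_pow_mulVec_injective hA hm e)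
  have h1 := (mem_equidistributingPoints_iff.mp hx _ hne).const_mul
    (ζ ^ h * (starRingEnd ℂ) (ζ ^ h'))
  rw [mul_zero] at h1
  refine h1.congr fun N => ?_
  rw [mul_left_comm, Finset.mul_sum]
  congr 1
  refine Finset.sum_congr rfl fun n _ => ?_
  have hz : ζ ^ n * (starRingEnd ℂ) (ζ ^ n) = 1 := by
    rw [Complex.mul_conj', norm_pow, hζ]; simp
  have h2 : (Aᵀ ^ n) *ᵥ ((Aᵀ ^ h) *ᵥ m - (Aᵀ ^ h') *ᵥ m) =
      (Aᵀ ^ (n + h)) *ᵥ m - (Aᵀ ^ (n + h')) *ᵥ m := by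
    rw [Matrix.mulVec_sub, Matrix.mulVec_mulVec, Matrix.mulVec_mulVec, pow_add, pow_add]
  beta_reduce
  rw [mFourier_iterate, h2, ← mFourier_mul_conj, mFourier_iterate, mFourier_iterate, map_mul,
    pow_add ζ n h, pow_add ζ n h', map_mul]
  linear_combination (-1 : ℂ) * ζ ^ h * (starRingEnd ℂ) (ζ ^ h') *
    UnitAddTorus.mFourier (Aᵀ ^ (n + h) *ᵥ m) x *
    (starRingEnd ℂ) (UnitAddTorus.mFourier (Aᵀ ^ (n + h') *ᵥ m) x) * hz

open BoundedContinuousFunction in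
/-- Bounded sequences which are either rotations `n ↦ ζ ^ n` with `‖ζ‖ = 1` or null sequences. The
closed algebra they generate contains the coordinates of every orbit of `A` that starts in the
contracted subspace or in the sum of the eigenspaces of modulus one. -/
def rotationOrNull : Set (ℕ →ᵇ ℂ) :=
  {g | (∃ ζ : ℂ, ‖ζ‖ = 1 ∧ ∀ n, g n = ζ ^ n) ∨ Tendsto g atTop (𝓝 0)}

open BoundedContinuousFunction in
theorem tendsto_zero_bounded_mul (g h : ℕ →ᵇ ℂ) (hh : Tendsto h atTop (𝓝 0)) :
    Tendsto (fun n => g n * h n) atTop (𝓝 0) := by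
  rw [tendsto_zero_iff_norm_tendsto_zero] at hh ⊢
  have h2 := hh.const_mul ‖g‖
  rw [mul_zero] at h2
  refine squeeze_zero (fun n => norm_nonneg _) (fun n => ?_) h2
  rw [norm_mul]
  exact mul_le_mul_of_nonneg_right (g.norm_coe_le_norm n) (norm_nonneg _)

theorem closure_rotationOrNull_subset :
    (Submonoid.closure rotationOrNull : Set _) ⊆ rotationOrNull := by
  intro g hg
  induction hg using Submonoid.closure_induction with
  | mem g hg => exact hg
  | one => exact Or.inl ⟨1, by simp, fun n => by simp⟩
  | mul g h _ _ hg hh =>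
    rcases hg with ⟨ζ, hζ, hg⟩ | hg
    · rcases hh with ⟨ξ, hξ, hh⟩ | hh
      · exact Or.inl ⟨ζ * ξ, by rw [norm_mul, hζ, hξ, one_mul], fun n => by
          rw [BoundedContinuousFunction.mul_apply, hg, hh, mul_pow]⟩
      · exact Or.inr (tendsto_zero_bounded_mul g h hh)
    · refine Or.inr ?_
      have := tendsto_zero_bounded_mul h g hg
      exact this.congr fun n => mul_comm _ _

theorem nullMean_mul_of_mem_adjoin {d : ℕ} {A : Matrix (Fin d) (Fin d) ℤ}
    (hA : IsQuasihyperbolic A) {x : UnitAddTorus (Fin d)} (hx : x ∈ equidistributingPoints A)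
    {m : Fin d → ℤ} (hm : m ≠ 0) {g : BoundedContinuousFunction ℕ ℂ}
    (hg : g ∈ (Algebra.adjoin ℂ rotationOrNull).topologicalClosure) :
    NullMean fun n => g n * UnitAddTorus.mFourier m ((toralMap A)^[n] x) := by
  have hspan : ∀ g ∈ Algebra.adjoin ℂ rotationOrNull,
      NullMean fun n => g n * UnitAddTorus.mFourier m ((toralMap A)^[n] x) := by
    intro g hg
    rw [← Subalgebra.mem_toSubmodule, Algebra.adjoin_eq_span_of_subset ℂ
      (closure_rotationOrNull_subset.trans Submodule.subset_span)] at hg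
    induction hg using Submodule.span_induction with
    | mem g hg =>
      rcases hg with ⟨ζ, hζ, hg⟩ | hg
      · simp only [hg]
        exact nullMean_rotation_mul hA hx hζ hm
      · refine NullMean.of_tendsto_zero ?_
        rw [tendsto_zero_iff_norm_tendsto_zero] at hg ⊢
        simpa only [norm_mul, norm_mFourier_apply, mul_one] using hg
    | zero => simp [NullMean]
    | add g h _ _ ihg ihh =>
      have := ihg.add ihh
      rw [add_zero] at this
      refine this.congr fun N => ?_
      simp only [BoundedContinuousFunction.add_apply, add_mul, Finset.sum_add_distrib, mul_add]
    | smul c g _ ih =>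
      have := ih.const_mul c
      rw [mul_zero] at this
      refine this.congr fun N => ?_
      simp only [BoundedContinuousFunction.smul_apply, smul_eq_mul, mul_assoc, ← Finset.mul_sum]
      ring
  refine tendsto_of_forall_approx fun ε hε => ?_
  obtain ⟨g', hg', hgg'⟩ := Metric.mem_closure_iff.mp hg ε hε
  refine ⟨_, 0, hspan g' hg', by simpa using hε.le, fun N => ?_⟩
  rw [cesaro_sub]
  refine norm_cesaro_le (fun n => ?_) N
  rw [← sub_mul, norm_mul, norm_mFourier_apply, mul_one, ← dist_eq_norm]
  exact (BoundedContinuousFunction.dist_coe_le_dist n).trans hgg'.le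

/-! ### Orbits of contracted and central vectors -/

theorem summable_norm_of_perturbed_contraction {E : Type*} [NormedAddCommGroup E]
    {v : ℕ → E} {e : ℕ → ℝ} {r : ℝ} (hr : r < 1) (he : Summable e)
    (he0 : ∀ n, 0 ≤ e n) (hv : ∀ n, ‖v (n + 1)‖ ≤ r * ‖v n‖ + e n) :
    Summable fun n => ‖v n‖ := by
  refine summable_of_sum_range_le (c := (‖v 0‖ + ∑' n, e n) / (1 - r))
    (fun n => norm_nonneg _) fun N => ?_
  rw [le_div_iff₀ (by linarith)]
  have h1 : ∑ n ∈ Finset.range N, ‖v n‖ ≤ ∑ n ∈ Finset.range (N + 1), ‖v n‖ :=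
    Finset.sum_le_sum_of_subset_of_nonneg (Finset.range_mono (Nat.le_succ _))
      fun _ _ _ => norm_nonneg _
  have h2 : ∑ n ∈ Finset.range (N + 1), ‖v n‖ ≤
      ‖v 0‖ + (r * ∑ n ∈ Finset.range N, ‖v n‖ + ∑' n, e n) := by
    rw [Finset.sum_range_succ']
    have := Finset.sum_le_sum fun n (_ : n ∈ Finset.range N) => hv n
    rw [Finset.sum_add_distrib, ← Finset.mul_sum] at this
    have h3 := he.sum_le_tsum (Finset.range N) fun n _ => he0 n
    linarith
  linarith

/-- Orbits of generalized eigenvectors for an eigenvalue of modulus less than one are summable. -/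
theorem summable_norm_pow_apply {E : Type*} [NormedAddCommGroup E] [NormedSpace ℂ E]
    (f : Module.End ℂ E) {μ : ℂ} (hμ : ‖μ‖ < 1) (k : ℕ) (u : E)
    (hu : ((f - algebraMap ℂ (Module.End ℂ E) μ) ^ k) u = 0) :
    Summable fun n : ℕ => ‖(f ^ n) u‖ := by
  induction k generalizing u with
  | zero =>
    have : u = 0 := by simpa using hu
    subst this
    simp [summable_zero]
  | succ k ih =>
    have hs := ih ((f - algebraMap ℂ (Module.End ℂ E) μ) u) (by
      rw [pow_succ] at hu; exact hu)
    refine summable_norm_of_perturbed_contraction hμ hs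
      (fun _ => norm_nonneg _) fun n => ?_
    have : (f ^ (n + 1)) u = μ • (f ^ n) u +
        (f ^ n) ((f - algebraMap ℂ (Module.End ℂ E) μ) u) := by
      rw [LinearMap.sub_apply, Module.algebraMap_end_apply, map_sub, map_smul, pow_succ]
      simp
    rw [this, ← norm_smul]
    exact norm_add_le _ _

/-- The set of those `u ∈ ℂ^d` all of whose orbit coordinates `n ↦ (A ^ n u) i` lie in the algebra
generated by rotations and null sequences. -/
def tameVectors {d : ℕ} (A : Matrix (Fin d) (Fin d) ℤ) : Submodule ℂ (Fin d → ℂ) where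
  carrier := {u | ∀ i, ∃ g ∈ Algebra.adjoin ℂ rotationOrNull,
    ∀ n : ℕ, g n = ((complexEnd A) ^ n) u i}
  add_mem' := by
    intro u v hu hv i
    obtain ⟨g, hg, hgu⟩ := hu i
    obtain ⟨h, hh, hhv⟩ := hv i
    exact ⟨g + h, add_mem hg hh, fun n => by simp [hgu, hhv]⟩
  zero_mem' := fun i => ⟨0, zero_mem _, fun n => by simp⟩
  smul_mem' := by
    intro c u hu i
    obtain ⟨g, hg, hgu⟩ := hu i
    exact ⟨c • g, Subalgebra.smul_mem _ hg c, fun n => by simp [hgu]⟩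

theorem maxGenEigenspace_le_tameVectors {d : ℕ} (A : Matrix (Fin d) (Fin d) ℤ) {μ : ℂ}
    (hμ : ‖μ‖ < 1) : (complexEnd A).maxGenEigenspace μ ≤ tameVectors A := by
  intro u hu i
  obtain ⟨k, hk⟩ := (Module.End.mem_maxGenEigenspace _ _ _).mp hu
  have hs := summable_norm_pow_apply (complexEnd A) hμ k u (by
    simpa [Algebra.algebraMap_eq_smul_one] using hk)
  have hc : ∀ n, ‖((complexEnd A) ^ n) u i‖ ≤ ‖((complexEnd A) ^ n) u‖ := fun n =>
    norm_le_pi_norm _ i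
  refine ⟨BoundedContinuousFunction.ofNormedAddCommGroupDiscrete
    (fun n => ((complexEnd A) ^ n) u i) (∑' n, ‖((complexEnd A) ^ n) u‖) fun n =>
      (hc n).trans (hs.le_tsum n fun _ _ => norm_nonneg _), ?_, fun n => rfl⟩
  refine Algebra.subset_adjoin (Or.inr ?_)
  exact squeeze_zero_norm hc hs.tendsto_atTop_zero

theorem pow_apply_of_apply_eq_smul {E : Type*} [AddCommGroup E] [Module ℂ E] (f : Module.End ℂ E)
    {μ : ℂ} {u : E} (hu : f u = μ • u) (n : ℕ) : (f ^ n) u = μ ^ n • u := by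
  induction n with
  | zero => simp
  | succ n ih => rw [pow_succ, Module.End.mul_apply, hu, map_smul, ih, smul_smul, pow_succ']

theorem eigenspace_le_tameVectors {d : ℕ} (A : Matrix (Fin d) (Fin d) ℤ) {μ : ℂ}
    (hμ : ‖μ‖ = 1) : (complexEnd A).eigenspace μ ≤ tameVectors A := by
  intro u hu i
  have hu' := Module.End.mem_eigenspace_iff.mp hu
  refine ⟨(u i) • BoundedContinuousFunction.ofNormedAddCommGroupDiscrete
    (fun n => μ ^ n) 1 fun n => by rw [norm_pow, hμ, one_pow], ?_, fun n => ?_⟩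
  · refine Subalgebra.smul_mem _ (Algebra.subset_adjoin ?_) _
    exact Or.inl ⟨μ, hμ, fun n => rfl⟩
  · rw [pow_apply_of_apply_eq_smul _ hu']
    simp [mul_comm]

theorem complexEnd_pow_ofReal {d : ℕ} (A : Matrix (Fin d) (Fin d) ℤ) (v : Fin d → ℝ) (n : ℕ) :
    ((complexEnd A) ^ n) (fun i => (v i : ℂ)) =
      fun i => ((((A ^ n).map (Int.cast : ℤ → ℝ)) *ᵥ v) i : ℂ) := by
  rw [← complexEnd_pow, complexEnd]
  funext i
  simp [Matrix.mulVec, dotProduct]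

theorem ofReal_mem_tameVectors {d : ℕ} {A : Matrix (Fin d) (Fin d) ℤ} {v : Fin d → ℝ}
    (hv : v ∈ contractedSubspace A ⊔ centralEigenspace A) :
    (fun i => (v i : ℂ)) ∈ tameVectors A := by
  obtain ⟨a, ha, b, hb, rfl⟩ := Submodule.mem_sup.mp hv
  have h1 : (fun i => (a i : ℂ)) ∈ tameVectors A :=
    (iSup₂_le fun μ hμ => maxGenEigenspace_le_tameVectors A hμ :
      (⨆ μ : ℂ, ⨆ _ : ‖μ‖ < 1, (complexEnd A).maxGenEigenspace μ) ≤ tameVectors A) ha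
  have h2 : (fun i => (b i : ℂ)) ∈ tameVectors A :=
    (iSup₂_le fun μ hμ => eigenspace_le_tameVectors A hμ :
      (⨆ μ : ℂ, ⨆ _ : ‖μ‖ = 1, (complexEnd A).eigenspace μ) ≤ tameVectors A) hb
  have := add_mem h1 h2
  simpa [Pi.add_def] using this

/-- Vectors of the contracted and central eigenspaces have bounded forward orbits. -/
theorem exists_bound_orbit {d : ℕ} {A : Matrix (Fin d) (Fin d) ℤ} {v : Fin d → ℝ}
    (hv : v ∈ contractedSubspace A ⊔ centralEigenspace A) :
    ∃ C, ∀ n : ℕ, ‖((A ^ n).map (Int.cast : ℤ → ℝ)) *ᵥ v‖ ≤ C := by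
  choose g _ hg using ofReal_mem_tameVectors hv
  refine ⟨∑ i, ‖g i‖, fun n => ?_⟩
  refine (pi_norm_le_iff_of_nonneg (by positivity)).mpr fun i => ?_
  have h1 := (g i).norm_coe_le_norm n
  rw [hg, complexEnd_pow_ofReal, Complex.norm_real] at h1
  exact h1.trans (Finset.single_le_sum (f := fun i => ‖g i‖) (fun j _ => norm_nonneg (g j))
    (Finset.mem_univ i))

/-- The set of equidistributing points is invariant under translation by the contracted and central
eigenspaces. -/
theorem add_torusProj_mem_equidistributingPoints {d : ℕ} {A : Matrix (Fin d) (Fin d) ℤ}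
    (hA : IsQuasihyperbolic A) {x : UnitAddTorus (Fin d)} (hx : x ∈ equidistributingPoints A)
    {v : Fin d → ℝ} (hv : v ∈ contractedSubspace A ⊔ centralEigenspace A) :
    x + torusProj v ∈ equidistributingPoints A := by
  refine mem_equidistributingPoints_iff.mpr fun m hm => ?_
  choose g hgm hg using ofReal_mem_tameVectors hv
  set G : BoundedContinuousFunction ℕ ℂ :=
    (2 * Real.pi * Complex.I : ℂ) • ∑ i, (m i : ℂ) • g i with hG
  have hGmem : G ∈ (Algebra.adjoin ℂ rotationOrNull).topologicalClosure :=
    Subalgebra.le_topologicalClosure _ (Subalgebra.smul_mem _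
      (sum_mem fun i _ => Subalgebra.smul_mem _ (hgm i) _) _)
  have hexp : NormedSpace.exp G ∈ (Algebra.adjoin ℂ rotationOrNull).topologicalClosure :=
    NormedSpace.exp_mem (R := ℂ) (Subalgebra.isClosed_topologicalClosure _) hGmem
  refine (nullMean_mul_of_mem_adjoin hA hx hm hexp).congr fun N => ?_
  congr 1
  refine Finset.sum_congr rfl fun n _ => ?_
  have h1 : (NormedSpace.exp G) n = Complex.exp (G n) := by
    rw [Complex.exp_eq_exp_ℂ]
    let ev : BoundedContinuousFunction ℕ ℂ →+* ℂ :=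
      { toFun := fun g => g n, map_one' := rfl, map_zero' := rfl,
        map_add' := fun _ _ => rfl, map_mul' := fun _ _ => rfl }
    exact NormedSpace.map_exp ev (BoundedContinuousFunction.evalCLM ℂ n).continuous G
  have h2 : G n = 2 * Real.pi * Complex.I *
      ∑ i, (m i : ℂ) * ((((A ^ n).map (Int.cast : ℤ → ℝ)) *ᵥ v) i : ℂ) := by
    simp [hG, BoundedContinuousFunction.coe_sum, hg, complexEnd_pow_ofReal]
  have h3 : (toralMap A)^[n] (x + torusProj v) = (toralMap A)^[n] x +
      torusProj (((A ^ n).map (Int.cast : ℤ → ℝ)) *ᵥ v) := by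
    rw [toralMap_iterate, toralMap_iterate, toralMap_add, toralMap_torusProj]
  beta_reduce
  rw [h1, h2, h3, mFourier_add_apply, mFourier_torusProj, mul_comm]

/-! ### Escaping a cover while avoiding hyperplanes -/

/-- The total weight of those members of the family `E` that meet `Q`. -/
def meetCost {X ι : Type*} (E : ι → Set X) (w : ι → ℝ≥0∞) (Q : Set X) : ℝ≥0∞ :=
  ∑' i, Set.indicator {i | (E i ∩ Q).Nonempty} w i

theorem le_meetCost {X ι : Type*} {E : ι → Set X} {w : ι → ℝ≥0∞} {Q : Set X} {i : ι}
    (h : (E i ∩ Q).Nonempty) : w i ≤ meetCost E w Q := by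
  have h1 : Set.indicator {i | (E i ∩ Q).Nonempty} w i = w i :=
    Set.indicator_of_mem (s := {i | (E i ∩ Q).Nonempty}) h w
  rw [← h1]
  exact ENNReal.le_tsum i

/-- The cell with index `f` of the grid of mesh `h` based at `z`. -/
def gridCell {k L : ℕ} (z : Fin k → ℝ) (h : ℝ) (f : Fin k → Fin L) : Set (Fin k → ℝ) :=
  Set.Icc (fun l => z l + h * (f l : ℕ)) (fun l => z l + h * (f l : ℕ) + h)

theorem gridCell_subset {k L : ℕ} (z : Fin k → ℝ) {h H : ℝ} (hh : 0 < h) (hL : L * h ≤ H)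
    (f : Fin k → Fin L) : gridCell z h f ⊆ Set.Icc z (fun l => z l + H) := by
  intro y hy
  refine ⟨fun l => ?_, fun l => ?_⟩
  · have := hy.1 l
    have h2 : 0 ≤ h * ((f l : ℕ) : ℝ) := by positivity
    dsimp only at this
    linarith
  · have := hy.2 l
    have h2 : ((f l : ℕ) : ℝ) + 1 ≤ L := by exact_mod_cast (f l).2
    have h3 : h * ((f l : ℕ) + 1) ≤ h * L := mul_le_mul_of_nonneg_left h2 hh.le
    dsimp only at this ⊢
    linarith

theorem card_filter_natAbs_sub_le {L : ℕ} (a : Fin L) (t : ℕ) :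
    (Finset.univ.filter fun b : Fin L => |((b : ℕ) : ℤ) - ((a : ℕ) : ℤ)| ≤ t).card
      ≤ 2 * t + 1 := by
  have h : (Finset.univ.filter fun b : Fin L => |((b : ℕ) : ℤ) - ((a : ℕ) : ℤ)| ≤ t).card ≤
      (Finset.Icc (((a : ℕ) : ℤ) - t) (((a : ℕ) : ℤ) + t)).card := by
    refine Finset.card_le_card_of_injOn (fun b => ((b : ℕ) : ℤ)) (fun b hb => ?_) ?_
    · have := abs_le.mp (Finset.mem_filter.mp hb).2
      simp only [Finset.coe_Icc, Set.mem_Icc]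
      omega
    · intro b _ c _ hbc
      have h1 : ((b : ℕ) : ℤ) = ((c : ℕ) : ℤ) := hbc
      exact Fin.ext (by exact_mod_cast h1)
  refine h.trans ?_
  simp only [Int.card_Icc]
  omega

theorem abs_sub_natCast_le {a b : ℕ} {t : ℕ} (h : |(a : ℝ) - b| ≤ t) :
    |((a : ℕ) : ℤ) - ((b : ℕ) : ℤ)| ≤ t := by
  exact_mod_cast h

open Classical in
theorem card_gridCell_meet_le {k L : ℕ} (z : Fin k → ℝ) {h : ℝ} (hh : 0 < h)
    {E : Set (Fin k → ℝ)} (hE : ∀ y ∈ E, ∀ y' ∈ E, ∀ l, |y l - y' l| ≤ h) :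
    (Finset.univ.filter fun f : Fin k → Fin L => (E ∩ gridCell z h f).Nonempty).card ≤ 5 ^ k := by
  rcases (Finset.univ.filter fun f : Fin k → Fin L =>
    (E ∩ gridCell z h f).Nonempty).eq_empty_or_nonempty with h0 | ⟨f₀, hf₀⟩
  · rw [h0]; simp
  obtain ⟨y₀, hy₀E, hy₀⟩ := (Finset.mem_filter.mp hf₀).2
  have hsub : (Finset.univ.filter fun f : Fin k → Fin L => (E ∩ gridCell z h f).Nonempty) ⊆
      Fintype.piFinset fun l => Finset.univ.filter fun b : Fin L =>
        |((b : ℕ) : ℤ) - ((f₀ l : ℕ) : ℤ)| ≤ (2 : ℕ) := by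
    intro f hf
    obtain ⟨y, hyE, hy⟩ := (Finset.mem_filter.mp hf).2
    refine Fintype.mem_piFinset.mpr fun l => Finset.mem_filter.mpr ⟨Finset.mem_univ _, ?_⟩
    apply abs_sub_natCast_le
    have h1 := abs_le.mp (hE y hyE y₀ hy₀E l)
    have h2 := hy.1 l
    have h3 := hy.2 l
    have h4 := hy₀.1 l
    have h5 := hy₀.2 l
    dsimp only at h2 h3 h4 h5
    refine abs_le.mpr ⟨?_, ?_⟩
    · refine le_of_mul_le_mul_left ?_ hh
      push_cast
      linarith
    · refine le_of_mul_le_mul_left ?_ hh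
      push_cast
      linarith
  refine (Finset.card_le_card hsub).trans ?_
  rw [Fintype.card_piFinset]
  refine (Finset.prod_le_prod' fun l _ => card_filter_natAbs_sub_le (f₀ l) 2).trans ?_
  simp

/-- Averaging over the cells of a grid, at most half of which are forbidden: some allowed cell
receives at most its share of the cost, up to a factor coming from the sets that meet several
cells. -/
theorem exists_cheap_gridCell {k L : ℕ} {ι : Type*} (E : ι → Set (Fin k → ℝ)) (w : ι → ℝ≥0∞)
    (hL : 0 < L) (z : Fin k → ℝ) {h H : ℝ} (hh : 0 < h) (hLH : L * h ≤ H)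
    (hE : ∀ i, (E i ∩ Set.Icc z (fun l => z l + H)).Nonempty →
      ∀ y ∈ E i, ∀ y' ∈ E i, ∀ l, |y l - y' l| ≤ h)
    (bad : Finset (Fin k → Fin L)) (hbad : 2 * bad.card ≤ L ^ k) :
    ∃ f ∉ bad, (L : ℝ≥0∞) ^ k * meetCost E w (gridCell z h f) ≤
      2 * 5 ^ k * meetCost E w (Set.Icc z (fun l => z l + H)) := by
  classical
  have hcard : bad.card + badᶜ.card = L ^ k := by
    rw [Finset.card_add_card_compl]; simp
  have hpos : 0 < L ^ k := by positivity
  have hne : badᶜ.Nonempty := Finset.card_pos.mp (by omega)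
  obtain ⟨f, hf, hmin⟩ := Finset.exists_min_image badᶜ (fun f => meetCost E w (gridCell z h f)) hne
  refine ⟨f, Finset.mem_compl.mp hf, ?_⟩
  have h1 : (badᶜ.card : ℝ≥0∞) * meetCost E w (gridCell z h f) ≤
      ∑ g ∈ badᶜ, meetCost E w (gridCell z h g) := by
    rw [← nsmul_eq_mul]
    exact Finset.card_nsmul_le_sum _ _ _ hmin
  have h2 : ∑ g ∈ badᶜ, meetCost E w (gridCell z h g) ≤
      5 ^ k * meetCost E w (Set.Icc z (fun l => z l + H)) := by
    calc ∑ g ∈ badᶜ, meetCost E w (gridCell z h g)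
        ≤ ∑ g, meetCost E w (gridCell z h g) :=
          Finset.sum_le_sum_of_subset (Finset.subset_univ _)
      _ = ∑' i, ∑ g : Fin k → Fin L,
            Set.indicator {i | (E i ∩ gridCell z h g).Nonempty} w i := by
          simp only [meetCost]
          rw [Summable.tsum_finsetSum fun _ _ => ENNReal.summable]
      _ ≤ ∑' i, 5 ^ k * Set.indicator
            {i | (E i ∩ Set.Icc z (fun l => z l + H)).Nonempty} w i := by
          refine ENNReal.tsum_le_tsum fun i => ?_
          by_cases hi : (E i ∩ Set.Icc z (fun l => z l + H)).Nonempty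
          · rw [Set.indicator_of_mem
              (s := {i | (E i ∩ Set.Icc z (fun l => z l + H)).Nonempty}) hi]
            simp only [Set.indicator_apply, Set.mem_ofPred_eq]
            rw [← Finset.sum_filter, Finset.sum_const, nsmul_eq_mul]
            gcongr
            exact_mod_cast card_gridCell_meet_le z hh (hE i hi)
          · refine (Finset.sum_eq_zero fun g _ => Set.indicator_of_notMem ?_ _).trans_le zero_le
            exact fun hg => hi (hg.mono (Set.inter_subset_inter_right _
              (gridCell_subset z hh hLH g)))
      _ = _ := by rw [ENNReal.tsum_mul_left, meetCost]
  have h3 : (L : ℝ≥0∞) ^ k ≤ 2 * (badᶜ.card : ℝ≥0∞) := by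
    exact_mod_cast (by omega : L ^ k ≤ 2 * badᶜ.card)
  calc (L : ℝ≥0∞) ^ k * meetCost E w (gridCell z h f)
      ≤ 2 * (badᶜ.card : ℝ≥0∞) * meetCost E w (gridCell z h f) := by gcongr
    _ ≤ 2 * (5 ^ k * meetCost E w (Set.Icc z (fun l => z l + H))) := by
        rw [mul_assoc]
        exact mul_le_mul_right (h1.trans h2) _
    _ = _ := by rw [mul_assoc]

/-- A thin slab around a hyperplane meets a number of grid cells that is of lower order. -/
theorem card_slab_le {k L : ℕ} (z : Fin k → ℝ) {h : ℝ} (hh : 0 < h) (a : Fin k → ℝ) (i : Fin k)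
    (hmax : ∀ l, |a l| ≤ |a i|) (hai : 0 < |a i|) {δ : ℝ} (hδ : 2 * δ ≤ |a i| * h)
    (S : Finset (Fin k → Fin L))
    (hS : ∀ f ∈ S, ∀ g ∈ S, ∃ y ∈ gridCell z h f, ∃ y' ∈ gridCell z h g,
      |∑ l, a l * (y l - y' l)| ≤ 2 * δ) :
    S.card ≤ (2 * (k + 1) + 1) * L ^ (k - 1) := by
  classical
  set φ : (Fin k → Fin L) → ({l : Fin k // l ≠ i} → Fin L) := fun f l => f l with hφ
  have hfib : ∀ b ∈ S.image φ, (S.filter fun f => φ f = b).card ≤ 2 * (k + 1) + 1 := by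
    intro b hb
    obtain ⟨f₀, hf₀, rfl⟩ := Finset.mem_image.mp hb
    have : (S.filter fun f => φ f = φ f₀).card ≤
        (Finset.univ.filter fun b : Fin L =>
          |((b : ℕ) : ℤ) - ((f₀ i : ℕ) : ℤ)| ≤ (k + 1 : ℕ)).card := by
      refine Finset.card_le_card_of_injOn (fun f => f i) (fun f hf => ?_) ?_
      · obtain ⟨hfS, hff⟩ := Finset.mem_filter.mp hf
        refine Finset.mem_coe.mpr (Finset.mem_filter.mpr ⟨Finset.mem_univ _, ?_⟩)
        apply abs_sub_natCast_le
        obtain ⟨y, hy, y', hy', hyy⟩ := hS f hfS f₀ hf₀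
        have hl : ∀ l, l ≠ i → |a l * (y l - y' l)| ≤ |a i| * h := by
          intro l hli
          have e : f l = f₀ l := congrFun hff ⟨l, hli⟩
          have h1 := hy.1 l
          have h2 := hy.2 l
          have h3 := hy'.1 l
          have h4 := hy'.2 l
          dsimp only at h1 h2 h3 h4
          rw [e] at h1 h2
          rw [abs_mul]
          refine mul_le_mul (hmax l) (abs_le.mpr ⟨by linarith, by linarith⟩) (abs_nonneg _)
            (abs_nonneg _)
        have hsum : |∑ l ∈ Finset.univ.erase i, a l * (y l - y' l)| ≤ (k - 1) * (|a i| * h) := by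
          refine (Finset.abs_sum_le_sum_abs _ _).trans ?_
          refine (Finset.sum_le_sum fun l hl' => hl l (Finset.ne_of_mem_erase hl')).trans ?_
          rw [Finset.sum_const, nsmul_eq_mul, Finset.card_erase_of_mem (Finset.mem_univ i),
            Finset.card_fin, Nat.cast_sub i.pos]
          simp
        rw [← Finset.add_sum_erase _ _ (Finset.mem_univ i)] at hyy
        have hmain : |a i| * |y i - y' i| ≤ k * (|a i| * h) := by
          rw [← abs_mul]
          have := abs_sub_abs_le_abs_add (a i * (y i - y' i))
            (∑ l ∈ Finset.univ.erase i, a l * (y l - y' l))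
          linarith
        have hdist : |y i - y' i| ≤ k * h := by
          refine le_of_mul_le_mul_left ?_ hai
          linarith
        have h0 := abs_le.mp hdist
        have h1 := hy.1 i
        have h2 := hy.2 i
        have h3 := hy'.1 i
        have h4 := hy'.2 i
        dsimp only at h1 h2 h3 h4
        push_cast
        refine abs_le.mpr ⟨?_, ?_⟩
        · refine le_of_mul_le_mul_left ?_ hh
          linarith
        · refine le_of_mul_le_mul_left ?_ hh
          linarith
      · intro f hf g hg hfg
        have h1 := (Finset.mem_filter.mp hf).2
        have h2 := (Finset.mem_filter.mp hg).2
        funext l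
        by_cases hli : l = i
        · subst hli; exact hfg
        · exact congrFun (h1.trans h2.symm) ⟨l, hli⟩
    exact this.trans (card_filter_natAbs_sub_le _ _)
  refine (Finset.card_le_mul_card_image S _ hfib).trans ?_
  gcongr
  refine (Finset.card_le_univ _).trans ?_
  simp

/-- Choice of the ratio `ρ ^ q` between consecutive cubes: the `q` forms treated in one step remove a
small part of the `⌊ρ ^ q⌋₊ ^ k` subcubes, and the gain `(ρ ^ q) ^ ε` beats any constant. -/
theorem exists_pow_large {ρ : ℝ} (hρ : 1 < ρ) (M X ε : ℝ) (hε : 0 < ε) :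
    ∃ q : ℕ, 0 < q ∧ 2 ≤ ρ ^ q ∧ M * q ≤ (⌊ρ ^ q⌋₊ : ℝ) ∧ X ≤ (ρ ^ q) ^ ε := by
  have h1 : Tendsto (fun q : ℕ => ρ ^ q) atTop atTop := tendsto_pow_atTop_atTop_of_one_lt hρ
  have h2 : Tendsto (fun q : ℕ => (ρ ^ q) ^ ε) atTop atTop := (tendsto_rpow_atTop hε).comp h1
  have h3 : Tendsto (fun q : ℕ => 2 * |M| * ((q : ℝ) ^ 1 / ρ ^ q)) atTop (𝓝 (2 * |M| * 0)) :=
    (tendsto_pow_const_div_const_pow_of_one_lt 1 hρ).const_mul _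
  rw [mul_zero] at h3
  obtain ⟨q, hq0, hq2, hqX, hqM⟩ := ((eventually_gt_atTop 0).and
    ((h1.eventually_ge_atTop 2).and ((h2.eventually_ge_atTop X).and
      (h3.eventually (gt_mem_nhds one_pos))))).exists
  refine ⟨q, hq0, hq2, ?_, hqX⟩
  have hpos : 0 < ρ ^ q := by linarith
  have h4 : 2 * |M| * q < ρ ^ q := by
    rw [pow_one, ← mul_div_assoc, div_lt_one hpos] at hqM
    exact hqM
  have h5 := Nat.sub_one_lt_floor (ρ ^ q)
  have h6 : M * q ≤ |M| * q := by
    gcongr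
    exact le_abs_self M
  linarith

/-- The inductive step of `exists_avoiding_outside_cover`: inside a cube of side `h` choose a subcube of side `h / ρ ^ q` which
avoids the slabs of the forms with index in a window of length `q` while the cost of the sets that
meet it drops by the factor `(ρ ^ q) ^ (-s)`. The invariant, a cost of at most the `s`-th power of
the side of the next cube, also forces all sets that meet the cube to be smaller than that side. -/
theorem exists_next_cube {k : ℕ} {ρ a b s : ℝ} (hρ : 1 < ρ) (ha : 0 < a) (hs : 0 < s)
    {q : ℕ} (hq2 : 2 ≤ ρ ^ q) (hqM : (2 * (2 * (k + 1) + 1) : ℝ) * q ≤ (⌊ρ ^ q⌋₊ : ℝ))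
    (hqX : (2 * 10 ^ k : ℝ) ≤ (ρ ^ q) ^ ((k : ℝ) - s)) (hk : 0 < k)
    {σ δ : ℝ} (hσ : 0 < σ) (hσb : k * b * σ * ρ ^ q ≤ 1 / 2) (hδ1 : δ ≤ 1 / 4)
    (hδ2 : 2 * δ ≤ a * (σ / ρ ^ q))
    {ℓ : ℕ → Fin k → ℝ} {β : ℕ → ℝ} (hℓb : ∀ n i, |ℓ n i| ≤ b * ρ ^ n)
    (hℓa : ∀ n, ∃ i, a * ρ ^ n ≤ |ℓ n i|)
    {ι : Type*} {E : ι → Set (Fin k → ℝ)} {r : ι → ℝ} (hr : ∀ i, 0 < r i)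
    (hE : ∀ i, ∀ y ∈ E i, ∀ y' ∈ E i, ∀ l, |y l - y' l| ≤ r i)
    (j : ℕ) (z : Fin k → ℝ)
    (hz : meetCost E (fun i => ENNReal.ofReal (r i ^ s))
      (Set.Icc z fun l => z l + σ / (ρ ^ q) ^ j) ≤ ENNReal.ofReal ((σ / (ρ ^ q) ^ (j + 1)) ^ s)) :
    ∃ z' : Fin k → ℝ,
      (Set.Icc z' (fun l => z' l + σ / (ρ ^ q) ^ (j + 1)) ⊆
        Set.Icc z (fun l => z l + σ / (ρ ^ q) ^ j)) ∧
      meetCost E (fun i => ENNReal.ofReal (r i ^ s))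
        (Set.Icc z' fun l => z' l + σ / (ρ ^ q) ^ (j + 1)) ≤
          ENNReal.ofReal ((σ / (ρ ^ q) ^ (j + 2)) ^ s) ∧
      ∀ y ∈ Set.Icc z' (fun l => z' l + σ / (ρ ^ q) ^ (j + 1)),
        ∀ n, j * q ≤ n → n < (j + 1) * q → ∀ p : ℤ, δ ≤ |∑ l, ℓ n l * y l + β n - p| := by
  classical
  set lam := ρ ^ q with hlam
  set L := ⌊lam⌋₊ with hLdef
  have hlam0 : 0 < lam := by linarith
  have hlam1 : 1 ≤ lam := by linarith
  have hL2 : lam / 2 ≤ L := by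
    have := Nat.sub_one_lt_floor lam
    rw [← hLdef] at this
    linarith
  have hLR : (0 : ℝ) < L := by linarith
  have hL : 0 < L := by exact_mod_cast hLR
  set h := σ / lam ^ (j + 1) with hh
  have hh0 : 0 < h := by positivity
  have hside : L * h ≤ σ / lam ^ j := by
    have h1 : lam * h = σ / lam ^ j := by
      rw [hh, pow_succ]
      field_simp
    rw [← h1]
    exact mul_le_mul_of_nonneg_right (Nat.floor_le hlam0.le) hh0.le
  -- every set meeting the cube is small, because its weight is
  have hsmall : ∀ i, (E i ∩ Set.Icc z (fun l => z l + σ / lam ^ j)).Nonempty →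
      ∀ y ∈ E i, ∀ y' ∈ E i, ∀ l, |y l - y' l| ≤ h := by
    intro i hi y hy y' hy' l
    refine (hE i y hy y' hy' l).trans ?_
    have h1 := (le_meetCost (w := fun i => ENNReal.ofReal (r i ^ s)) hi).trans hz
    rw [ENNReal.ofReal_le_ofReal_iff (by positivity)] at h1
    exact (Real.rpow_le_rpow_iff (hr i).le hh0.le hs).mp h1
  set B : ℕ → Finset (Fin k → Fin L) := fun n => Finset.univ.filter fun f =>
    ∃ y ∈ gridCell z h f, ∃ p : ℤ, |∑ l, ℓ n l * y l + β n - p| < δ with hB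
  set bad : Finset (Fin k → Fin L) := (Finset.Ico (j * q) ((j + 1) * q)).biUnion B with hbaddef
  have hBcard : ∀ n ∈ Finset.Ico (j * q) ((j + 1) * q),
      (B n).card ≤ (2 * (k + 1) + 1) * L ^ (k - 1) := by
    intro n hn
    obtain ⟨hn1, hn2⟩ := Finset.mem_Ico.mp hn
    have hlow : lam ^ j ≤ ρ ^ n := by
      rw [hlam, ← pow_mul, mul_comm]
      exact pow_le_pow_right₀ hρ.le hn1
    have hupp : ρ ^ n ≤ lam ^ (j + 1) := by
      rw [hlam, ← pow_mul, mul_comm]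
      exact pow_le_pow_right₀ hρ.le hn2.le
    obtain ⟨i₁, hi₁⟩ := hℓa n
    obtain ⟨i, -, hi⟩ := Finset.exists_max_image Finset.univ (fun l => |ℓ n l|) ⟨i₁, Finset.mem_univ _⟩
    have hmax : ∀ l, |ℓ n l| ≤ |ℓ n i| := fun l => hi l (Finset.mem_univ l)
    have hai : a * lam ^ j ≤ |ℓ n i| :=
      ((mul_le_mul_of_nonneg_left hlow ha.le).trans hi₁).trans (hmax i₁)
    have hah : a * (σ / lam) ≤ |ℓ n i| * h := by
      have h1 : a * (σ / lam) = a * lam ^ j * h := by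
        rw [hh, pow_succ]
        field_simp
      rw [h1]
      exact mul_le_mul_of_nonneg_right hai hh0.le
    refine card_slab_le z hh0 (ℓ n) i hmax (lt_of_lt_of_le (by positivity) hai)
      (hδ2.trans hah) _ fun f hf g hg => ?_
    obtain ⟨y, hy, p, hyp⟩ := (Finset.mem_filter.mp hf).2
    obtain ⟨y', hy', p', hyp'⟩ := (Finset.mem_filter.mp hg).2
    refine ⟨y, hy, y', hy', ?_⟩
    have hyQ := gridCell_subset z hh0 hside f hy
    have hyQ' := gridCell_subset z hh0 hside g hy'
    set Δ := ∑ l, ℓ n l * (y l - y' l) with hΔ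
    have hΔeq : Δ = ∑ l, ℓ n l * y l - ∑ l, ℓ n l * y' l := by
      rw [hΔ, ← Finset.sum_sub_distrib]
      exact Finset.sum_congr rfl fun l _ => by ring
    -- the form oscillates by at most `1 / 2` on the cube, so the nearby integers agree
    have hosc : |Δ| ≤ 1 / 2 := by
      have h1 : ∀ l ∈ Finset.univ, |ℓ n l * (y l - y' l)| ≤ b * lam ^ (j + 1) * (σ / lam ^ j) := by
        intro l _
        have e1 := hyQ.1 l
        have e2 := hyQ.2 l
        have e3 := hyQ'.1 l
        have e4 := hyQ'.2 l
        dsimp only at e2 e4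
        have hbpos : 0 ≤ b := by
          have := (abs_nonneg _).trans (hℓb n l)
          exact nonneg_of_mul_nonneg_left this (by positivity)
        rw [abs_mul]
        refine mul_le_mul ((hℓb n l).trans (mul_le_mul_of_nonneg_left hupp hbpos))
          (abs_le.mpr ⟨by linarith, by linarith⟩) (abs_nonneg _) (by positivity)
      have h2 := (Finset.abs_sum_le_sum_abs (fun l => ℓ n l * (y l - y' l)) Finset.univ).trans
        (Finset.sum_le_sum h1)
      rw [Finset.sum_const, Finset.card_fin, nsmul_eq_mul] at h2
      have h3 : (k : ℝ) * (b * lam ^ (j + 1) * (σ / lam ^ j)) = k * b * σ * lam := by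
        rw [pow_succ]
        field_simp
      rw [h3] at h2
      exact h2.trans hσb
    have hpp : p = p' := by
      have h1 := abs_lt.mp hyp
      have h2 := abs_lt.mp hyp'
      have h3 := abs_le.mp hosc
      have h4 : |((p - p' : ℤ) : ℝ)| < 1 := by
        push_cast
        exact abs_lt.mpr ⟨by linarith, by linarith⟩
      have h5 : |p - p'| < 1 := by exact_mod_cast h4
      exact sub_eq_zero.mp (Int.abs_lt_one_iff.mp h5)
    subst hpp
    have h1 := abs_lt.mp hyp
    have h2 := abs_lt.mp hyp'
    exact abs_le.mpr ⟨by linarith, by linarith⟩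
  have hbad : 2 * bad.card ≤ L ^ k := by
    have h1 : bad.card ≤ q * ((2 * (k + 1) + 1) * L ^ (k - 1)) := by
      refine (Finset.card_biUnion_le_card_mul _ _ _ hBcard).trans_eq ?_
      rw [Nat.card_Ico, add_mul, one_mul, Nat.add_sub_cancel_left]
    have h2 : 2 * (2 * (k + 1) + 1) * q ≤ L := by exact_mod_cast hqM
    calc 2 * bad.card ≤ 2 * (q * ((2 * (k + 1) + 1) * L ^ (k - 1))) := by gcongr
      _ = (2 * (2 * (k + 1) + 1) * q) * L ^ (k - 1) := by ring
      _ ≤ L * L ^ (k - 1) := by gcongr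
      _ = L ^ k := by rw [← pow_succ', Nat.sub_add_cancel hk]
  obtain ⟨f, hf, hcost⟩ := exists_cheap_gridCell E (fun i => ENNReal.ofReal (r i ^ s)) hL z hh0
    hside hsmall bad hbad
  refine ⟨fun l => z l + h * (f l : ℕ), gridCell_subset z hh0 hside f, ?_, ?_⟩
  · have h1 : (L : ℝ≥0∞) ^ k * meetCost E (fun i => ENNReal.ofReal (r i ^ s)) (gridCell z h f) ≤
        ENNReal.ofReal (2 * 5 ^ k * h ^ s) := by
      refine hcost.trans ((mul_le_mul_right hz _).trans_eq ?_)
      rw [ENNReal.ofReal_mul (by positivity), ENNReal.ofReal_mul (by positivity),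
        ENNReal.ofReal_pow (by positivity)]
      simp
    have hLk : (L : ℝ≥0∞) ^ k = ENNReal.ofReal ((L : ℝ) ^ k) := by
      rw [ENNReal.ofReal_pow hLR.le, ENNReal.ofReal_natCast]
    have hLk0 : 0 < (L : ℝ) ^ k := by positivity
    rw [hLk, mul_comm, ← ENNReal.le_div_iff_mul_le (Or.inl (ENNReal.ofReal_pos.mpr hLk0).ne')
      (Or.inl ENNReal.ofReal_ne_top), ← ENNReal.ofReal_div_of_pos hLk0] at h1
    refine h1.trans (ENNReal.ofReal_le_ofReal ?_)
    have h2 : σ / lam ^ (j + 2) = h / lam := by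
      rw [hh, pow_succ _ (j + 1), div_div]
    rw [h2, Real.div_rpow hh0.le hlam0.le, div_le_div_iff₀ hLk0 (by positivity)]
    have h3 : 2 * 10 ^ k * lam ^ s ≤ lam ^ k := by
      have h4 : lam ^ ((k : ℝ) - s) * lam ^ s = lam ^ k := by
        rw [← Real.rpow_add hlam0, sub_add_cancel, Real.rpow_natCast]
      rw [← h4]
      gcongr
    have h5 : 2 * 5 ^ k * lam ^ s ≤ (L : ℝ) ^ k := by
      have h6 : (lam / 2) ^ k ≤ (L : ℝ) ^ k := by gcongr
      refine le_trans ?_ h6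
      rw [div_pow, le_div_iff₀ (by positivity)]
      have h7 : (10 : ℝ) ^ k = 5 ^ k * 2 ^ k := by rw [← mul_pow]; norm_num
      rw [h7] at h3
      linarith
    calc 2 * 5 ^ k * h ^ s * lam ^ s = h ^ s * (2 * 5 ^ k * lam ^ s) := by ring
      _ ≤ h ^ s * (L : ℝ) ^ k := by gcongr
  · intro y hy n hn1 hn2 p
    by_contra! hcon
    refine hf (Finset.mem_biUnion.mpr ⟨n, Finset.mem_Ico.mpr ⟨hn1, hn2⟩, ?_⟩)
    exact Finset.mem_filter.mpr ⟨Finset.mem_univ _, y, hy, p, hcon⟩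

/-- A lacunary sequence of affine forms on `ℝ^k` can be kept away from the integers by points lying
outside any prescribed cover of small `s`-dimensional content, for every `s < k`. The constants do
not depend on the constant terms of the forms nor on the cover. -/
theorem exists_avoiding_outside_cover {k : ℕ} (hk : 0 < k) {ρ a b s σ₀ : ℝ} (hρ : 1 < ρ)
    (ha : 0 < a) (hb : 0 < b) (hs : 0 < s) (hsk : s < k) (hσ₀ : 0 < σ₀) :
    ∃ δ > 0, ∃ c > 0, ∀ (ℓ : ℕ → Fin k → ℝ) (β : ℕ → ℝ),
      (∀ n i, |ℓ n i| ≤ b * ρ ^ n) → (∀ n, ∃ i, a * ρ ^ n ≤ |ℓ n i|) →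
      ∀ (ι : Type) (E : ι → Set (Fin k → ℝ)) (r : ι → ℝ), (∀ i, 0 < r i) →
        (∀ i, ∀ y ∈ E i, ∀ y' ∈ E i, ∀ l, |y l - y' l| ≤ r i) →
        ∑' i, ENNReal.ofReal (r i ^ s) ≤ ENNReal.ofReal c →
        ∃ z ∈ Set.Icc (0 : Fin k → ℝ) (fun _ => σ₀), (∀ i, z ∉ E i) ∧
          ∀ n, ∀ p : ℤ, δ ≤ |∑ l, ℓ n l * z l + β n - p| := by
  obtain ⟨q, hq0, hq2, hqM, hqX⟩ := exists_pow_large hρ (2 * (2 * (k + 1) + 1)) (2 * 10 ^ k)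
    ((k : ℝ) - s) (by linarith)
  have hkR : (0 : ℝ) < k := by exact_mod_cast hk
  have hlam0 : 0 < ρ ^ q := by linarith
  set σ := min σ₀ (1 / (2 * k * b * ρ ^ q)) with hσdef
  have hσ : 0 < σ := lt_min hσ₀ (by positivity)
  have hσb : k * b * σ * ρ ^ q ≤ 1 / 2 := by
    have h1 : σ ≤ 1 / (2 * k * b * ρ ^ q) := min_le_right _ _
    rw [le_div_iff₀ (by positivity)] at h1
    linarith
  set δ := min (1 / 4) (a * (σ / ρ ^ q) / 2) with hδdef
  have hδ : 0 < δ := lt_min (by norm_num) (by positivity)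
  have hδ2 : 2 * δ ≤ a * (σ / ρ ^ q) := by
    have := min_le_right (1 / 4) (a * (σ / ρ ^ q) / 2)
    linarith
  refine ⟨δ, hδ, (σ / ρ ^ q) ^ s, by positivity, ?_⟩
  intro ℓ β hℓb hℓa ι E r hr hE hsum
  set P : ℕ → (Fin k → ℝ) → Prop := fun j z => meetCost E (fun i => ENNReal.ofReal (r i ^ s))
      (Set.Icc z fun l => z l + σ / (ρ ^ q) ^ j) ≤ ENNReal.ofReal ((σ / (ρ ^ q) ^ (j + 1)) ^ s)
    with hP
  have hP0 : P 0 0 := by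
    refine le_trans (ENNReal.tsum_le_tsum fun i => Set.indicator_le_self _ _ i) ?_
    simpa using hsum
  have hstep := fun j z (hz : P j z) => exists_next_cube (β := β) hρ ha hs hq2 hqM hqX hk hσ hσb
    (min_le_left _ _ : δ ≤ 1 / 4) hδ2 hℓb hℓa hr hE j z hz
  choose F hFsub hFP hFav using hstep
  let z : ∀ j, {z // P j z} := fun j =>
    Nat.rec ⟨0, hP0⟩ (fun j z => ⟨F j z.1 z.2, hFP j z.1 z.2⟩) j
  set Q : ℕ → Set (Fin k → ℝ) := fun j => Set.Icc (z j).1 fun l => (z j).1 l + σ / (ρ ^ q) ^ j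
    with hQ
  obtain ⟨y, hy⟩ := IsCompact.nonempty_iInter_of_sequence_nonempty_isCompact_isClosed Q
    (fun j => hFsub j (z j).1 (z j).2)
    (fun j => Set.nonempty_Icc.mpr fun l => by
      have : 0 ≤ σ / (ρ ^ q) ^ j := by positivity
      dsimp only
      linarith) isCompact_Icc (fun j => isClosed_Icc)
  have hyQ := Set.mem_iInter.mp hy
  refine ⟨y, ⟨(hyQ 0).1, fun l => ?_⟩, fun i hi => ?_, fun n p => ?_⟩
  · have h1 := (hyQ 0).2 l
    have h2 : (z 0).1 = 0 := rfl
    simp only [h2, Pi.zero_apply, pow_zero, div_one, zero_add] at h1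
    exact h1.trans (min_le_left _ _)
  · have h1 : ∀ j : ℕ, r i ≤ σ / (ρ ^ q) ^ (j + 1) := by
      intro j
      have h2 := (le_meetCost (E := E) (w := fun i => ENNReal.ofReal (r i ^ s))
        (Q := Q j) ⟨y, hi, hyQ j⟩).trans (z j).2
      rw [ENNReal.ofReal_le_ofReal_iff (by positivity)] at h2
      exact (Real.rpow_le_rpow_iff (hr i).le (by positivity) hs).mp h2
    have h3 : Tendsto (fun j : ℕ => σ / (ρ ^ q) ^ (j + 1)) atTop (𝓝 0) :=
      ((tendsto_pow_atTop_atTop_of_one_lt (by linarith : 1 < ρ ^ q)).comp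
        (tendsto_add_atTop_nat 1)).const_div_atTop σ
    exact absurd (ge_of_tendsto' h3 h1) (not_le.mpr (hr i))
  · exact hFav (n / q) (z (n / q)).1 (z (n / q)).2 y (hyQ (n / q + 1)) n
      (Nat.div_mul_le_self n q) (by rw [mul_comm]; exact Nat.lt_mul_div_succ n hq0) p

/-! ### An expanded line or plane -/

theorem re_complexEnd_pow {d : ℕ} (A : Matrix (Fin d) (Fin d) ℤ) (v : Fin d → ℂ) (n : ℕ)
    (i : Fin d) :
    (((A ^ n).map (Int.cast : ℤ → ℝ)) *ᵥ fun j => (v j).re) i =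
      (((complexEnd A) ^ n) v i).re := by
  rw [← complexEnd_pow, complexEnd]
  simp [Matrix.mulVec, dotProduct, Complex.re_sum]

theorem eq_zero_of_mul_pow_le {ρ t C : ℝ} (hρ : 1 < ρ) (ht : 0 ≤ t)
    (h : ∀ n : ℕ, t * ρ ^ n ≤ C) : t = 0 := by
  by_contra hne
  have htpos : 0 < t := lt_of_le_of_ne ht (Ne.symm hne)
  obtain ⟨n, hn⟩ := pow_unbounded_of_one_lt (C / t) hρ
  rw [div_lt_iff₀ htpos] at hn
  linarith [h n]

/-- A linear embedding of `ℝ^k` into `ℝ^d` along which one coordinate `i₀` of the iterates of `A`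
is given by linear forms `ℓ n` of purely exponential size `ρ ^ n`, and along which the orbits of
nonzero vectors are unbounded. Here `k` is `1` or `2` according to whether the expanding eigenvalue
is real; restricting to eigenvectors keeps polynomial factors out of the size of the forms. -/
structure ExpandingChart {d : ℕ} (A : Matrix (Fin d) (Fin d) ℤ) where
  k : ℕ
  k_pos : 0 < k
  chart : (Fin k → ℝ) →ₗ[ℝ] (Fin d → ℝ)
  i₀ : Fin d
  ρ : ℝ
  one_lt_ρ : 1 < ρ
  a : ℝ
  a_pos : 0 < a
  b : ℝ
  b_pos : 0 < b
  ℓ : ℕ → Fin k → ℝ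
  abs_ℓ_le : ∀ n l, |ℓ n l| ≤ b * ρ ^ n
  le_abs_ℓ : ∀ n, ∃ l, a * ρ ^ n ≤ |ℓ n l|
  mulVec_chart : ∀ n z, (((A ^ n).map (Int.cast : ℤ → ℝ)) *ᵥ chart z) i₀ = ∑ l, ℓ n l * z l
  eq_zero_of_bounded : ∀ z, (∃ C, ∀ n : ℕ, ‖((A ^ n).map (Int.cast : ℤ → ℝ)) *ᵥ chart z‖ ≤ C) →
    z = 0

theorem nonempty_expandingChart_of_real {d : ℕ} (A : Matrix (Fin d) (Fin d) ℤ) {μ : ℂ}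
    (hμ : 1 < ‖μ‖) (him : μ.im = 0) {w : Fin d → ℂ} (hw : complexEnd A w = μ • w) {i₀ : Fin d}
    (hi₀ : (w i₀).re ≠ 0) : Nonempty (ExpandingChart A) := by
  have hpow : ∀ n : ℕ, μ ^ n = ((μ.re ^ n : ℝ) : ℂ) := fun n => by
    rw [Complex.ofReal_pow]
    congr 1
    exact Complex.ext (by simp) (by simp [him])
  have hnorm : ‖μ‖ = |μ.re| := by
    have := hpow 1
    rw [pow_one, pow_one] at this
    conv_lhs => rw [this]
    rw [Complex.norm_real, Real.norm_eq_abs]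
  have horb : ∀ (n : ℕ) (z : Fin 1 → ℝ), (((A ^ n).map (Int.cast : ℤ → ℝ)) *ᵥ
      (z 0 • fun j => (w j).re)) i₀ = z 0 * (μ.re ^ n * (w i₀).re) := by
    intro n z
    rw [Matrix.mulVec_smul, Pi.smul_apply, re_complexEnd_pow, pow_apply_of_apply_eq_smul _ hw, hpow,
      Pi.smul_apply, smul_eq_mul, smul_eq_mul, Complex.re_ofReal_mul]
  refine ⟨{
    k := 1
    k_pos := one_pos
    chart := (LinearMap.proj 0).smulRight (fun j => (w j).re)
    i₀ := i₀
    ρ := ‖μ‖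
    one_lt_ρ := hμ
    a := |(w i₀).re|
    a_pos := abs_pos.mpr hi₀
    b := |(w i₀).re|
    b_pos := abs_pos.mpr hi₀
    ℓ := fun n _ => μ.re ^ n * (w i₀).re
    abs_ℓ_le := fun n l => by rw [abs_mul, abs_pow, hnorm, mul_comm]
    le_abs_ℓ := fun n => ⟨0, by rw [abs_mul, abs_pow, hnorm, mul_comm]⟩
    mulVec_chart := fun n z => by
      rw [LinearMap.smulRight_apply, LinearMap.proj_apply, horb]
      simp [mul_comm]
    eq_zero_of_bounded := ?_ }⟩
  rintro z ⟨C, hC⟩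
  have h0 : |z 0| * |(w i₀).re| = 0 := by
    refine eq_zero_of_mul_pow_le (C := C) hμ (by positivity) fun n => ?_
    have h1 := (norm_le_pi_norm _ i₀).trans (hC n)
    rw [LinearMap.smulRight_apply, LinearMap.proj_apply, horb, Real.norm_eq_abs, abs_mul, abs_mul,
      abs_pow, ← hnorm] at h1
    linarith
  funext l
  rw [Subsingleton.elim l 0]
  rcases mul_eq_zero.mp h0 with h | h
  · exact abs_eq_zero.mp h
  · exact absurd (abs_eq_zero.mp h) hi₀

theorem nonempty_expandingChart_of_not_real {d : ℕ} (A : Matrix (Fin d) (Fin d) ℤ) {μ : ℂ}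
    (hμ : 1 < ‖μ‖) (him : μ.im ≠ 0) {w : Fin d → ℂ} (hw : complexEnd A w = μ • w) {i₀ : Fin d}
    (hi₀ : w i₀ ≠ 0) : Nonempty (ExpandingChart A) := by
  let g : ℂ →ₗ[ℝ] (Fin d → ℝ) :=
    { toFun := fun ξ j => (ξ * w j).re
      map_add' := fun ξ η => by funext j; simp [add_mul]
      map_smul' := fun c ξ => by funext j; simp [mul_assoc] }
  have hg : ∀ ξ j, g ξ j = (ξ * w j).re := fun _ _ => rfl
  have horb : ∀ (n : ℕ) (ξ : ℂ), ((A ^ n).map (Int.cast : ℤ → ℝ)) *ᵥ g ξ = g (ξ * μ ^ n) := by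
    intro n ξ
    funext j
    have h1 := re_complexEnd_pow A (ξ • w) n j
    rw [map_smul, pow_apply_of_apply_eq_smul _ hw] at h1
    calc _ = (((A ^ n).map (Int.cast : ℤ → ℝ)) *ᵥ fun j => ((ξ • w) j).re) j := rfl
      _ = _ := by rw [h1, hg]; simp [mul_assoc]
  -- if `Re (ξ w) = 0` then `w` is a multiple of a real eigenvector, so `μ` is real
  have hker : LinearMap.ker g = ⊥ := by
    rw [LinearMap.ker_eq_bot']
    intro ξ hξ
    by_contra hne
    apply him
    have h1 : ∀ n : ℕ, (ξ * μ ^ n * w i₀).re = 0 := fun n => by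
      rw [← hg, ← horb, hξ, Matrix.mulVec_zero, Pi.zero_apply]
    have h2 := h1 0
    have h3 := h1 1
    rw [pow_zero, mul_one] at h2
    have h4 : ξ * μ ^ 1 * w i₀ = μ * (ξ * w i₀) := by ring
    rw [h4, Complex.mul_re, h2, mul_zero, zero_sub, neg_eq_zero] at h3
    rcases mul_eq_zero.mp h3 with h5 | h5
    · exact h5
    · exact absurd (Complex.ext h2 h5) (mul_ne_zero hne hi₀)
  obtain ⟨K, hK, hanti⟩ := LinearMap.exists_antilipschitzWith g hker
  let e : (Fin 2 → ℝ) →ₗ[ℝ] ℂ :=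
    { toFun := fun z => ⟨z 0, z 1⟩
      map_add' := fun z z' => Complex.ext (by simp) (by simp)
      map_smul' := fun c z => Complex.ext (by simp) (by simp) }
  refine ⟨{
    k := 2
    k_pos := two_pos
    chart := g ∘ₗ e
    i₀ := i₀
    ρ := ‖μ‖
    one_lt_ρ := hμ
    a := ‖w i₀‖ / 2
    a_pos := by positivity
    b := ‖w i₀‖
    b_pos := norm_pos_iff.mpr hi₀
    ℓ := fun n => ![(μ ^ n * w i₀).re, -(μ ^ n * w i₀).im]
    abs_ℓ_le := fun n l => by
      have h1 : ‖μ ^ n * w i₀‖ = ‖w i₀‖ * ‖μ‖ ^ n := by rw [norm_mul, norm_pow, mul_comm]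
      rw [← h1]
      fin_cases l
      · exact Complex.abs_re_le_norm _
      · change |-(μ ^ n * w i₀).im| ≤ _
        rw [abs_neg]
        exact Complex.abs_im_le_norm _
    le_abs_ℓ := fun n => by
      have h1 : ‖μ ^ n * w i₀‖ = ‖w i₀‖ * ‖μ‖ ^ n := by rw [norm_mul, norm_pow, mul_comm]
      have h2 := Complex.norm_le_abs_re_add_abs_im (μ ^ n * w i₀)
      rcases le_total |(μ ^ n * w i₀).re| |(μ ^ n * w i₀).im| with h | h
      · exact ⟨1, by simp only [Matrix.cons_val_one, Matrix.cons_val_fin_one, abs_neg]; linarith⟩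
      · exact ⟨0, by simp only [Matrix.cons_val_zero]; linarith⟩
    mulVec_chart := fun n z => by
      rw [LinearMap.comp_apply, horb, hg, Fin.sum_univ_two]
      have : e z * μ ^ n * w i₀ = e z * (μ ^ n * w i₀) := mul_assoc _ _ _
      rw [this, Complex.mul_re]
      simp only [Matrix.cons_val_zero, Matrix.cons_val_one, Matrix.cons_val_fin_one]
      change z 0 * _ - z 1 * _ = _
      ring
    eq_zero_of_bounded := ?_ }⟩
  rintro z ⟨C, hC⟩
  have h0 : ‖e z‖ = 0 := by
    refine eq_zero_of_mul_pow_le (C := K * C) hμ (norm_nonneg _) fun n => ?_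
    have h1 := hC n
    rw [LinearMap.comp_apply, horb] at h1
    have h2 := hanti.le_mul_dist (e z * μ ^ n) 0
    rw [dist_zero_right, map_zero, dist_zero_right, norm_mul, norm_pow] at h2
    exact h2.trans (by gcongr)
  have h1 := norm_eq_zero.mp h0
  funext l
  fin_cases l
  · exact congrArg Complex.re h1
  · exact congrArg Complex.im h1

theorem nonempty_expandingChart {d : ℕ} (hd : d ≠ 0) {A : Matrix (Fin d) (Fin d) ℤ}
    (hA : IsQuasihyperbolic A) : Nonempty (ExpandingChart A) := by
  obtain ⟨μ, hμ, hev⟩ := exists_eigenvalue_one_lt_norm hd hA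
  obtain ⟨w, hw⟩ := hev.exists_hasEigenvector
  obtain ⟨i₀, hi₀⟩ := Function.ne_iff.mp hw.2
  by_cases him : μ.im = 0
  · by_cases hre : (w i₀).re = 0
    · -- multiply the eigenvector by `I` to make the real part of its `i₀`-th coordinate nonzero
      refine nonempty_expandingChart_of_real A hμ him (w := Complex.I • w) (i₀ := i₀) ?_ ?_
      · rw [map_smul, hw.apply_eq_smul, smul_comm]
      · have : (w i₀).im ≠ 0 := fun h => hi₀ (Complex.ext hre h)
        simpa using this
    · exact nonempty_expandingChart_of_real A hμ him hw.apply_eq_smul hre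
  · exact nonempty_expandingChart_of_not_real A hμ him hw.apply_eq_smul hi₀

/-- If the `i`-th coordinate of the orbit stays away from `0` then the orbit cannot
equidistribute. -/
theorem mem_nonEquidistributingPoints_of_forall_le_norm {d : ℕ} {A : Matrix (Fin d) (Fin d) ℤ}
    {x : UnitAddTorus (Fin d)} (i : Fin d) {δ : ℝ} (hδ : 0 < δ)
    (h : ∀ n : ℕ, δ ≤ ‖(toralMap A)^[n] x i‖) : x ∈ nonEquidistributingPoints A := by
  intro hx
  set φ : C(UnitAddTorus (Fin d), ℝ) := ⟨fun y => max 0 (δ - ‖y i‖), by fun_prop⟩ with hφ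
  have h1 := hx ⟨fun y => (φ y : ℂ), by fun_prop⟩
  simp only [ContinuousMap.coe_mk] at h1
  have h2 : ∀ n, φ ((toralMap A)^[n] x) = 0 := fun n => max_eq_left (by linarith [h n])
  simp only [h2, Complex.ofReal_zero, Finset.sum_const_zero, mul_zero] at h1
  have h3 := tendsto_nhds_unique h1 tendsto_const_nhds
  rw [integral_complex_ofReal] at h3
  have h4 : ∫ y, φ y ∂torusHaar d = 0 := by exact_mod_cast h3
  have h5 : 0 < ∫ y, φ y ∂torusHaar d := by
    refine φ.continuous.integral_pos_of_hasCompactSupport_nonneg_nonzero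
      (HasCompactSupport.of_compactSpace _) (fun y => le_max_left _ _) (x := 0) ?_
    simp [hφ, hδ.not_ge]
  exact h5.ne' h4

/-! ### Hausdorff dimension from slices along translates of a subspace -/

theorem norm_torusProj_le {d : ℕ} (v : Fin d → ℝ) : ‖torusProj v‖ ≤ ‖v‖ := by
  refine (pi_norm_le_iff_of_nonneg (norm_nonneg v)).mpr fun i => ?_
  exact (QuotientAddGroup.norm_mk_le_norm (m := v i)).trans (norm_le_pi_norm v i)

theorem norm_torusProj_eq {d : ℕ} {v : Fin d → ℝ} (hv : ‖v‖ ≤ 1 / 2) : ‖torusProj v‖ = ‖v‖ := by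
  refine le_antisymm (norm_torusProj_le v)
    ((pi_norm_le_iff_of_nonneg (norm_nonneg _)).mpr fun i => ?_)
  have h1 : ‖torusProj v i‖ = |v i| := by
    refine (AddCircle.norm_coe_eq_abs_iff 1 one_ne_zero).mpr ?_
    simpa using (norm_le_pi_norm v i).trans hv
  rw [Real.norm_eq_abs, ← h1]
  exact norm_le_pi_norm _ i

theorem dimH_le_torus {d : ℕ} (F : Set (UnitAddTorus (Fin d))) : dimH F ≤ d := by
  have hlip : LipschitzWith 1 (torusProj (d := d)) := by
    refine LipschitzWith.of_dist_le_mul fun v w => ?_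
    rw [dist_eq_norm, dist_eq_norm, ← torusProj_sub, NNReal.coe_one, one_mul]
    exact norm_torusProj_le _
  have hsurj : Set.range (torusProj (d := d)) = Set.univ := by
    refine Set.range_eq_univ.mpr fun x => ?_
    choose v hv using fun i => QuotientAddGroup.mk_surjective (x i)
    exact ⟨v, funext hv⟩
  calc dimH F ≤ dimH (Set.range (torusProj (d := d))) := by
        rw [hsurj]; exact dimH_mono (Set.subset_univ _)
    _ ≤ dimH (Set.univ : Set (Fin d → ℝ)) := hlip.dimH_range_le
    _ = d := Real.dimH_univ_pi_fin d

theorem haarAddCircle_closedBall_le (x : UnitAddCircle) (ε : ℝ) :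
    AddCircle.haarAddCircle (Metric.closedBall x ε) ≤ ENNReal.ofReal (2 * ε) := by
  have h1 := AddCircle.volume_closedBall 1 (x := x) ε
  rw [AddCircle.volume_eq_smul_haarAddCircle, ENNReal.ofReal_one, one_smul] at h1
  rw [h1]
  exact ENNReal.ofReal_le_ofReal (min_le_right _ _)

theorem torusHaar_closedBall_le {d : ℕ} (x : UnitAddTorus (Fin d)) {ε : ℝ} (hε : 0 ≤ ε) :
    torusHaar d (Metric.closedBall x ε) ≤ ENNReal.ofReal ((2 * ε) ^ d) := by
  rw [closedBall_pi _ hε, torusHaar, Measure.pi_pi]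
  refine (Finset.prod_le_prod' fun i _ => haarAddCircle_closedBall_le (x i) ε).trans ?_
  rw [Finset.prod_const, Finset.card_fin, ENNReal.ofReal_pow (by positivity)]

/-- The set of points from which a translation by the image of the unit cube leads into `E`. -/
def tube {d k : ℕ} (φ : (Fin k → ℝ) →ₗ[ℝ] (Fin d → ℝ)) (E : Set (UnitAddTorus (Fin d))) :
    Set (UnitAddTorus (Fin d)) :=
  {x | ∃ z ∈ Set.Icc (0 : Fin k → ℝ) 1, x + torusProj (φ z) ∈ E}

/-- The tube of a set of diameter `r` is covered by about `r ^ (-k)` balls of radius comparable to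
`r`. -/
theorem torusHaar_tube_le {d k : ℕ} (φ : (Fin k → ℝ) →ₗ[ℝ] (Fin d → ℝ)) {Λ : ℝ} (hΛ : 0 ≤ Λ)
    (hφ : ∀ z, ‖φ z‖ ≤ Λ * ‖z‖) {E : Set (UnitAddTorus (Fin d))} {r : ℝ} (hr0 : 0 < r)
    (hr1 : r ≤ 1) (hE : ∀ x ∈ E, ∀ y ∈ E, dist x y ≤ r) :
    torusHaar d (tube φ E) ≤
      ENNReal.ofReal (2 ^ k * (2 * (1 + Λ)) ^ d * r ^ ((d : ℝ) - k)) := by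
  rcases E.eq_empty_or_nonempty with rfl | ⟨e, he⟩
  · have : tube φ (∅ : Set (UnitAddTorus (Fin d))) = ∅ := by
      ext x; simp [tube]
    rw [this, measure_empty]
    exact zero_le
  set M := ⌊1 / r⌋₊ + 1 with hM
  have hMr : (M : ℝ) ≤ 2 / r := by
    have h1 : (⌊1 / r⌋₊ : ℝ) ≤ 1 / r := Nat.floor_le (by positivity)
    have h2 : 1 ≤ 1 / r := by rwa [le_div_iff₀ hr0, one_mul]
    have h3 : 2 / r = 1 / r + 1 / r := by ring
    rw [hM, h3]
    push_cast
    linarith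
  have hsub : tube φ E ⊆ ⋃ f : Fin k → Fin M,
      Metric.closedBall (e - torusProj (φ fun l => r * (f l : ℕ))) ((1 + Λ) * r) := by
    rintro x ⟨z, hz, hxz⟩
    have hlt : ∀ l, ⌊z l / r⌋₊ < M := fun l => by
      refine Nat.lt_succ_of_le (Nat.floor_le_floor ?_)
      exact div_le_div_of_nonneg_right (hz.2 l) hr0.le
    refine Set.mem_iUnion.mpr ⟨fun l => ⟨⌊z l / r⌋₊, hlt l⟩, ?_⟩
    set g : Fin k → ℝ := fun l => r * (⌊z l / r⌋₊ : ℕ) with hg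
    have hzg : ‖z - g‖ ≤ r := by
      refine (pi_norm_le_iff_of_nonneg hr0.le).mpr fun l => ?_
      have h1 : (⌊z l / r⌋₊ : ℝ) ≤ z l / r := Nat.floor_le (div_nonneg (hz.1 l) hr0.le)
      have h2 := Nat.lt_floor_add_one (z l / r)
      rw [le_div_iff₀ hr0] at h1
      rw [div_lt_iff₀ hr0] at h2
      rw [Pi.sub_apply, Real.norm_eq_abs, hg]
      exact abs_le.mpr ⟨by dsimp only; linarith, by dsimp only; linarith⟩
    rw [Metric.mem_closedBall, dist_eq_norm]
    have heq : x - (e - torusProj (φ g)) = (x + torusProj (φ z) - e) - torusProj (φ (z - g)) := by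
      rw [map_sub, torusProj_sub]
      abel
    change ‖x - (e - torusProj (φ g))‖ ≤ _
    rw [heq]
    calc _ ≤ ‖x + torusProj (φ z) - e‖ + ‖torusProj (φ (z - g))‖ := norm_sub_le _ _
      _ ≤ r + Λ * r := by
          refine add_le_add ?_ ?_
          · rw [← dist_eq_norm]; exact hE _ hxz _ he
          · exact (norm_torusProj_le _).trans ((hφ _).trans (mul_le_mul_of_nonneg_left hzg hΛ))
      _ = (1 + Λ) * r := by ring
  refine (measure_mono hsub).trans ((measure_iUnion_fintype_le _ _).trans ?_)
  refine (Finset.sum_le_sum fun f _ => torusHaar_closedBall_le _ (by positivity)).trans ?_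
  rw [Finset.sum_const, nsmul_eq_mul, Finset.card_univ, Fintype.card_fun, Fintype.card_fin,
    Fintype.card_fin, ← ENNReal.ofReal_natCast, ← ENNReal.ofReal_mul (by positivity)]
  refine ENNReal.ofReal_le_ofReal ?_
  rw [Real.rpow_sub hr0, Real.rpow_natCast, Real.rpow_natCast, Nat.cast_pow]
  calc (M : ℝ) ^ k * (2 * ((1 + Λ) * r)) ^ d ≤ (2 / r) ^ k * (2 * ((1 + Λ) * r)) ^ d := by gcongr
    _ = _ := by
      rw [div_pow, ← mul_assoc 2, mul_pow (2 * (1 + Λ)) r]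
      field_simp

/-- A set of zero Hausdorff measure has covers of arbitrarily small `t`-cost, with positive radii in
place of diameters. -/
theorem exists_cover_of_hausdorffMeasure_eq_zero {X : Type*} [MetricSpace X] [MeasurableSpace X]
    [BorelSpace X] {t : ℝ} (ht : 0 < t) {F : Set X} (hF : Measure.hausdorffMeasure t F = 0)
    {η : ℝ} (hη : 0 < η) :
    ∃ (E : ℕ → Set X) (r : ℕ → ℝ), F ⊆ ⋃ n, E n ∧ (∀ n, 0 < r n) ∧ (∀ n, r n ≤ 1) ∧
      (∀ n, ∀ x ∈ E n, ∀ y ∈ E n, dist x y ≤ r n) ∧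
      ∑' n, ENNReal.ofReal (r n ^ t) ≤ ENNReal.ofReal η := by
  rw [Measure.hausdorffMeasure_apply] at hF
  have h0 := le_of_eq hF
  rw [iSup₂_le_iff] at h0
  have h1 := h0 (1 / 2) (by simp)
  have hη2 : (0 : ℝ≥0∞) < ENNReal.ofReal (η / 2) := by simpa using hη
  have h2 := lt_of_le_of_lt h1 hη2
  simp only [iInf_lt_iff] at h2
  obtain ⟨E, hFE, hdiam, hsum⟩ := h2
  obtain ⟨ε, hε0, hεsum⟩ := ENNReal.exists_pos_sum_of_countable hη2.ne' ℕ
  have hfin : ∀ n, Metric.ediam (E n) ≠ ∞ := fun n => ne_top_of_le_ne_top (by simp) (hdiam n)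
  have hdR : ∀ n, (Metric.ediam (E n)).toReal ≤ 1 / 2 := fun n => by
    have := ENNReal.toReal_mono (by simp) (hdiam n)
    simpa using this
  have hr : ∀ n, ∃ ρ : ℝ, (Metric.ediam (E n)).toReal < ρ ∧ ρ ≤ 1 ∧
      ρ ^ t < (Metric.ediam (E n)).toReal ^ t + ε n := by
    intro n
    set D := (Metric.ediam (E n)).toReal with hD
    have hcont : Tendsto (fun ρ : ℝ => ρ ^ t) (𝓝[>] D) (𝓝 (D ^ t)) :=
      (Real.continuousAt_rpow_const D t (Or.inr ht.le)).tendsto.mono_left nhdsWithin_le_nhds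
    have e1 := hcont.eventually (gt_mem_nhds (show D ^ t < D ^ t + ε n by
      have : (0 : ℝ) < ε n := hε0 n
      linarith))
    have e2 : ∀ᶠ ρ in 𝓝[>] D, ρ ≤ 1 :=
      nhdsWithin_le_nhds ((gt_mem_nhds (show D < 1 by linarith [hdR n])).mono fun _ h => h.le)
    obtain ⟨ρ, h1, h2, h3⟩ := (e1.and (e2.and self_mem_nhdsWithin)).exists
    exact ⟨ρ, h3, h2, h1⟩
  choose ρ hρD hρ1 hρt using hr
  refine ⟨E, ρ, hFE, fun n => lt_of_le_of_lt ENNReal.toReal_nonneg (hρD n), hρ1,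
    fun n x hx y hy => ?_, ?_⟩
  · refine le_trans ?_ (hρD n).le
    rw [dist_edist]
    exact ENNReal.toReal_mono (hfin n) (Metric.edist_le_ediam_of_mem hx hy)
  · have hterm : ∀ n, ENNReal.ofReal (ρ n ^ t) ≤
        (⨆ _ : (E n).Nonempty, Metric.ediam (E n) ^ t) + ε n := by
      intro n
      have e1 : Metric.ediam (E n) ^ t ≤ ⨆ _ : (E n).Nonempty, Metric.ediam (E n) ^ t := by
        rcases (E n).eq_empty_or_nonempty with h | h
        · rw [h, Metric.ediam_empty, ENNReal.zero_rpow_of_pos ht]; exact zero_le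
        · exact le_iSup (fun _ : (E n).Nonempty => Metric.ediam (E n) ^ t) h
      have e2 : Metric.ediam (E n) ^ t = ENNReal.ofReal ((Metric.ediam (E n)).toReal ^ t) := by
        rw [← ENNReal.ofReal_rpow_of_nonneg ENNReal.toReal_nonneg ht.le,
          ENNReal.ofReal_toReal (hfin n)]
      refine le_trans ?_ (add_le_add e1 le_rfl)
      rw [e2, ← ENNReal.ofReal_coe_nnreal, ← ENNReal.ofReal_add (by positivity) (by positivity)]
      exact ENNReal.ofReal_le_ofReal (hρt n).le
    calc ∑' n, ENNReal.ofReal (ρ n ^ t)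
        ≤ ∑' n, ((⨆ _ : (E n).Nonempty, Metric.ediam (E n) ^ t) + ε n) :=
          ENNReal.tsum_le_tsum hterm
      _ = ∑' n, (⨆ _ : (E n).Nonempty, Metric.ediam (E n) ^ t) + ∑' n, (ε n : ℝ≥0∞) :=
          ENNReal.tsum_add
      _ ≤ ENNReal.ofReal (η / 2) + ENNReal.ofReal (η / 2) := add_le_add hsum.le hεsum.le
      _ = ENNReal.ofReal η := by
          rw [← ENNReal.ofReal_add (by positivity) (by positivity), add_halves]

/-- If, from almost every point of the torus, the slice of `F` in the direction of a `k`-dimensional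
subspace is, uniformly, too large to be covered at small `s`-dimensional cost for every `s < k`,
then `F` has full Hausdorff dimension. -/
theorem le_dimH_of_slices {d k : ℕ} (hk : 0 < k) (φ : (Fin k → ℝ) →ₗ[ℝ] (Fin d → ℝ))
    (hφ : LinearMap.ker φ = ⊥) {F G : Set (UnitAddTorus (Fin d))}
    (hG : ∀ᵐ x ∂torusHaar d, x ∈ G)
    (H : ∀ s σ₀ : ℝ, 0 < s → s < k → 0 < σ₀ → ∃ c > 0, ∀ x ∈ G,
      ∀ (ι : Type) (E : ι → Set (Fin k → ℝ)) (r : ι → ℝ), (∀ i, 0 < r i) →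
        (∀ i, ∀ y ∈ E i, ∀ y' ∈ E i, ∀ l, |y l - y' l| ≤ r i) →
        ∑' i, ENNReal.ofReal (r i ^ s) ≤ ENNReal.ofReal c →
        ∃ z ∈ Set.Icc (0 : Fin k → ℝ) (fun _ => σ₀), (∀ i, z ∉ E i) ∧
          x + torusProj (φ z) ∈ F) :
    (d : ℝ≥0∞) ≤ dimH F := by
  by_contra! hlt
  have hd : (0 : ℝ≥0∞) < d := zero_le.trans_lt hlt
  have hd' : (0 : ℝ) < d := by exact_mod_cast hd
  have hkR : (0 : ℝ) < k := by exact_mod_cast hk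
  obtain ⟨t, ht1, ht2⟩ := ENNReal.lt_iff_exists_nnreal_btwn.mp
    (max_lt hlt (show ENNReal.ofReal ((d : ℝ) - k) < d by
      rw [← ENNReal.ofReal_natCast, ENNReal.ofReal_lt_ofReal_iff hd']
      linarith))
  have htd : (t : ℝ) < d := by exact_mod_cast ht2
  have htF : Measure.hausdorffMeasure (t : ℝ) F = 0 :=
    hausdorffMeasure_of_dimH_lt ((le_max_left _ _).trans_lt ht1)
  have ht0 : (0 : ℝ) < t := by
    have : (0 : ℝ≥0∞) < t := zero_le.trans_lt ht1
    exact_mod_cast this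
  have htk : (d : ℝ) - k < t := by
    have h1 := (le_max_right _ _).trans_lt ht1
    rw [← ENNReal.ofReal_coe_nnreal, ENNReal.ofReal_lt_ofReal_iff ht0] at h1
    exact h1
  set s : ℝ := t - (d - k) with hs
  have hs0 : 0 < s := by linarith
  have hsk : s < k := by linarith
  obtain ⟨K, hK, hanti⟩ := LinearMap.exists_antilipschitzWith φ hφ
  set Λ : ℝ := ‖φ.toContinuousLinearMap‖ with hΛdef
  have hΛ : 0 ≤ Λ := norm_nonneg _
  have hφΛ : ∀ z, ‖φ z‖ ≤ Λ * ‖z‖ := fun z => φ.toContinuousLinearMap.le_opNorm z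
  have hφK : ∀ z, ‖z‖ ≤ K * ‖φ z‖ := fun z => by
    have := hanti.le_mul_dist z 0
    rwa [dist_zero_right, map_zero, dist_zero_right] at this
  have hK0 : (0 : ℝ) < K := by exact_mod_cast hK
  -- on a cube of this size the covering map is isometric along the slices
  set σ₀ : ℝ := min 1 (1 / (2 * (Λ + 1))) with hσ₀
  have hσ₀pos : 0 < σ₀ := lt_min one_pos (by positivity)
  have hσ₀1 : σ₀ ≤ 1 := min_le_left _ _
  have hσ₀Λ : Λ * σ₀ ≤ 1 / 2 := by
    have h1 : σ₀ ≤ 1 / (2 * (Λ + 1)) := min_le_right _ _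
    rw [le_div_iff₀ (by positivity)] at h1
    nlinarith
  obtain ⟨c, hc, hH⟩ := H s σ₀ hs0 hsk hσ₀pos
  set B : ℝ := (K : ℝ) ^ s * (2 ^ k * (2 * (1 + Λ)) ^ d) with hB
  have hB0 : 0 < B := by positivity
  obtain ⟨E, r, hFE, hr0, hr1, hEr, hsum⟩ :=
    exists_cover_of_hausdorffMeasure_eq_zero ht0 htF (η := c / (2 * B)) (by positivity)
  set τ : ℕ → Set (UnitAddTorus (Fin d)) := fun n =>
    toMeasurable (torusHaar d) (tube φ (E n)) with hτ
  have hpoint : ∀ x ∈ G, ENNReal.ofReal c ≤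
      ∑' n, (τ n).indicator (fun _ => ENNReal.ofReal ((K * r n) ^ s)) x := by
    intro x hx
    by_contra! hcon
    set sl : ℕ → Set (Fin k → ℝ) := fun n =>
      {z | z ∈ Set.Icc (0 : Fin k → ℝ) (fun _ => σ₀) ∧ x + torusProj (φ z) ∈ E n} with hsl
    set I : Set ℕ := {n | (sl n).Nonempty} with hI
    have hdiam : ∀ n, ∀ y ∈ sl n, ∀ y' ∈ sl n, ∀ l, |y l - y' l| ≤ K * r n := by
      rintro n y ⟨hy, hyE⟩ y' ⟨hy', hyE'⟩ l
      have h1 : ‖y - y'‖ ≤ σ₀ := by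
        refine (pi_norm_le_iff_of_nonneg hσ₀pos.le).mpr fun l => ?_
        have a1 := hy.1 l
        have a2 := hy.2 l
        have a3 := hy'.1 l
        have a4 := hy'.2 l
        simp only [Pi.zero_apply] at a1 a3
        dsimp only at a2 a4
        rw [Pi.sub_apply, Real.norm_eq_abs]
        exact abs_le.mpr ⟨by linarith, by linarith⟩
      have h2 : ‖φ (y - y')‖ ≤ 1 / 2 :=
        (hφΛ _).trans ((mul_le_mul_of_nonneg_left h1 hΛ).trans hσ₀Λ)
      have h3 : ‖φ (y - y')‖ ≤ r n := by
        have h4 := hEr n _ hyE _ hyE'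
        rw [dist_eq_norm, add_sub_add_left_eq_sub, ← torusProj_sub, ← map_sub,
          norm_torusProj_eq h2] at h4
        exact h4
      calc |y l - y' l| = ‖(y - y') l‖ := rfl
        _ ≤ ‖y - y'‖ := norm_le_pi_norm _ l
        _ ≤ K * ‖φ (y - y')‖ := hφK _
        _ ≤ K * r n := by gcongr
    obtain ⟨z, hz, hzE, hzF⟩ := hH x hx I (fun n => sl n) (fun n => K * r n)
      (fun n => mul_pos hK0 (hr0 n)) (fun n => hdiam n) (by
        rw [tsum_subtype I (fun n => ENNReal.ofReal ((K * r n) ^ s))]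
        refine le_trans (ENNReal.tsum_le_tsum fun n => ?_) hcon.le
        by_cases hn : n ∈ I
        · obtain ⟨z, hz, hzE⟩ := hn
          have hxτ : x ∈ τ n := subset_toMeasurable _ _
            ⟨z, ⟨hz.1, fun l => (hz.2 l).trans hσ₀1⟩, hzE⟩
          rw [Set.indicator_of_mem hxτ]
          exact Set.indicator_le_self _ _ n
        · rw [Set.indicator_of_notMem hn]
          exact zero_le)
    obtain ⟨n, hn⟩ := Set.mem_iUnion.mp (hFE hzF)
    exact hzE ⟨n, z, hz, hn⟩ ⟨hz, hn⟩
  have hint : ENNReal.ofReal c ≤ ∑' n, ENNReal.ofReal ((K * r n) ^ s) * torusHaar d (τ n) := by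
    calc ENNReal.ofReal c = ∫⁻ _, ENNReal.ofReal c ∂torusHaar d := by simp
      _ ≤ ∫⁻ x, ∑' n, (τ n).indicator (fun _ => ENNReal.ofReal ((K * r n) ^ s)) x
            ∂torusHaar d := lintegral_mono_ae (by filter_upwards [hG] with x hx using hpoint x hx)
      _ = ∑' n, ENNReal.ofReal ((K * r n) ^ s) * torusHaar d (τ n) := by
        rw [lintegral_tsum fun n =>
          (measurable_const.indicator (measurableSet_toMeasurable _ _)).aemeasurable]
        congr 1
        funext n
        rw [lintegral_indicator_const (measurableSet_toMeasurable _ _)]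
  have hterm : ∀ n, ENNReal.ofReal ((K * r n) ^ s) * torusHaar d (τ n) ≤
      ENNReal.ofReal B * ENNReal.ofReal (r n ^ (t : ℝ)) := by
    intro n
    have h1 := torusHaar_tube_le φ hΛ hφΛ (hr0 n) (hr1 n) (hEr n)
    rw [← measure_toMeasurable] at h1
    refine (mul_le_mul_right h1 _).trans_eq ?_
    rw [← ENNReal.ofReal_mul (by have := hr0 n; positivity), ← ENNReal.ofReal_mul hB0.le]
    congr 1
    have h2 : r n ^ (t : ℝ) = r n ^ s * r n ^ ((d : ℝ) - k) := by
      rw [← Real.rpow_add (hr0 n), hs, sub_add_cancel]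
    rw [h2, Real.mul_rpow hK0.le (hr0 n).le, hB]
    ring
  have hfin := hint.trans (ENNReal.tsum_le_tsum hterm)
  rw [ENNReal.tsum_mul_left] at hfin
  have h3 := hfin.trans (mul_le_mul_right hsum _)
  rw [← ENNReal.ofReal_mul hB0.le, ENNReal.ofReal_le_ofReal_iff (by positivity)] at h3
  have h4 : B * (c / (2 * B)) = c / 2 := by field_simp
  linarith

/-! ### Transporting slices into the equidistribution set -/

/-- A linear map into `U + W` can be corrected modulo `W`, linearly, to one with values in `U`. -/
theorem exists_linearMap_of_sup_eq_top {k : ℕ} {V : Type*} [AddCommGroup V] [Module ℝ V]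
    {U W : Submodule ℝ V} (h : U ⊔ W = ⊤) (f : (Fin k → ℝ) →ₗ[ℝ] V) :
    ∃ φ : (Fin k → ℝ) →ₗ[ℝ] V, ∀ z, φ z ∈ U ∧ f z - φ z ∈ W := by
  have h1 : ∀ l : Fin k, ∃ u ∈ U, f (Pi.single l 1) - u ∈ W := fun l => by
    obtain ⟨u, hu, w, hw, huw⟩ := Submodule.mem_sup.mp
      (show f (Pi.single l 1) ∈ U ⊔ W by rw [h]; trivial)
    exact ⟨u, hu, by rw [← huw, add_sub_cancel_left]; exact hw⟩
  choose u hu hw using h1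
  refine ⟨(Pi.basisFun ℝ (Fin k)).constr ℝ u, fun z => ?_⟩
  have h2 : (Pi.basisFun ℝ (Fin k)).constr ℝ u z = ∑ l, z l • u l := by
    simp [Module.Basis.constr_apply_fintype]
  have h3 : f z = ∑ l, z l • f (Pi.single l 1) := by
    conv_lhs => rw [pi_eq_sum_univ' z]
    simp [map_sum]
  rw [h2, h3, ← Finset.sum_sub_distrib]
  refine ⟨sum_mem fun l _ => U.smul_mem _ (hu l), sum_mem fun l _ => ?_⟩
  rw [← smul_sub]
  exact W.smul_mem _ (hw l)

theorem theorem4p3 {d : ℕ} (S T : Matrix (Fin d) (Fin d) ℤ)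
    (hS : IsQuasihyperbolic S) (hT : IsQuasihyperbolic T)
    (hS_nontrivial : contractedSubspace S ⊔ centralEigenspace S ≠ ⊥)
    (hT_nontrivial : contractedSubspace T ⊔ centralEigenspace T ≠ ⊥)
    (hspan : (contractedSubspace S ⊔ centralEigenspace S) ⊔
      (contractedSubspace T ⊔ centralEigenspace T) = ⊤) :
    dimH (equidistributingPoints S ∩ nonEquidistributingPoints T) = d := by
  refine le_antisymm (dimH_le_torus _) ?_
  have hd : d ≠ 0 := by
    rintro rfl
    exact hT_nontrivial (Submodule.eq_bot_of_subsingleton)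
  obtain ⟨X⟩ := nonempty_expandingChart hd hT
  obtain ⟨φ, hφ⟩ := exists_linearMap_of_sup_eq_top hspan X.chart
  have hker : LinearMap.ker φ = ⊥ := by
    refine LinearMap.ker_eq_bot'.mpr fun z hz => X.eq_zero_of_bounded z ?_
    have h1 := (hφ z).2
    rw [hz, sub_zero] at h1
    exact exists_bound_orbit h1
  refine le_dimH_of_slices X.k_pos φ hker (ae_mem_equidistributingPoints hS)
    fun s σ₀ hs hsk hσ₀ => ?_
  obtain ⟨δ, hδ, c, hc, hav⟩ := exists_avoiding_outside_cover X.k_pos X.one_lt_ρ X.a_pos X.b_pos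
    hs hsk hσ₀
  refine ⟨c, hc, fun x hx ι E r hr hE hsum => ?_⟩
  choose β hβ using fun n : ℕ => QuotientAddGroup.mk_surjective ((toralMap T)^[n] x X.i₀)
  obtain ⟨z, hz, hzE, hzav⟩ := hav X.ℓ β X.abs_ℓ_le X.le_abs_ℓ ι E r hr hE hsum
  refine ⟨z, hz, hzE, add_torusProj_mem_equidistributingPoints hS hx (hφ z).1, fun hmem => ?_⟩
  -- translating by a vector of the contracted and central eigenspaces of `T` replaces `φ z` by
  -- `X.chart z`
  have hmem' : x + torusProj (X.chart z) ∈ equidistributingPoints T := by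
    have h1 := add_torusProj_mem_equidistributingPoints hT hmem (hφ z).2
    rwa [add_assoc, ← torusProj_add, add_sub_cancel] at h1
  refine mem_nonEquidistributingPoints_of_forall_le_norm X.i₀ hδ (fun n => ?_) hmem'
  have h1 : (toralMap T)^[n] (x + torusProj (X.chart z)) X.i₀ =
      ((∑ l, X.ℓ n l * z l + β n : ℝ) : UnitAddCircle) := by
    rw [toralMap_iterate, toralMap_add, toralMap_torusProj, ← toralMap_iterate, Pi.add_apply,
      torusProj, X.mulVec_chart, AddCircle.coe_add, add_comm]
    congr 1
    exact (hβ n).symm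
  rw [h1, UnitAddCircle.norm_eq]
  exact hzav n _

end
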